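/- For $\varepsilon\in(0,1]$ let $\mathscr G$ be the solution operator $f\mapsto u$ on $L^2([0,1])$ of the convection-diffusion problem $-\varepsilon u''+a u'+c u=f$ on $(0,1)$, $u(0)=u(1)=0$. That is, $u=\mathscr G(f)$ is the unique $u\in H_0^1(0,1)$ with $\varepsilon\int_0^1u'v'+\int_0^1au'v+\int_0^1cuv=\int_0^1fv$ for all $v\in H^1_0(0,1)$. Here $a,c\in C^1([0,1])$ and $a\ge\alpha>0$. For $l>0$ let $\mu=\mathcal N(0,\mathcal C)$ be the centred Gaussian measure on $L^2([0,1])$ whose covariance $\mathcal C$ is the integral operator with kernel $k(x,y)=\sum_{j\in\mathbb Z}\exp(-|x-y-j|^2/(2l^2))$. A ReLU network is a composition $\mathcal A_L\circ\sigma\circ\mathcal A_{L-1}\circ\cdots\circ\sigma\circ\mathcal A_1$ of affine maps $\mathcal A_i:\mathbb R^{d_{i-1}}\to\mathbb R^{d_i}$ and the componentwise ReLU $\sigma$. It has $d_1+\dots+d_{L-1}$ hidden neurons and $d_0+\dots+d_L$ neurons in total. For a ReLU branch net $\beta:\mathbb R^m\to\mathbb R^p$ and a ReLU trunk net $\tau=(\tau_0,\dots,\tau_p):\mathbb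 R\to\mathbb R^{p+1}$, the DeepONet with sensors $x_j=j/m$ is $$\mathscr N(f)=\tau_0+\sum_{k=1}^p\beta_k\big(f(x_1),\dots,f(x_m)\big)\,\tau_k ,$$ where $f(x_j)$ is the value of the continuous representative of $f$ (which exists for $\mu$-almost every $f$) and is set to $0$ if $f$ has none. **Theorem.** Fix $a,c,\alpha$ as above, and let $\Lambda\ge0$, $l_0>0$, $n>0$ and $\gamma\in(0,1)$. There is a constant $C>0$, depending only on these data and in particular independent of $\varepsilon,m,p$ and of $l\in(0,l_0]$, such that the following holds. Let $\varepsilon\in(0,1]$ be such that the solution operator $\mathscr G$ is well defined and Lipschitz continuous on $L^2([0,1])$ with constant $\Lambda$, let $l\in(0,l_0]$, and let $m=2M+1$ and $p=2K+1$ with integers $M,K\ge0$. Then there are a ReLU branch net $\beta$ with at most $C\max\{m,p\}$ neurons, and a ReLU trunk net $\tau$ with at most $C\,p^{\frac{n+1}{2-\gamma}}$ hidden neurons, hence at most $C\max\{p,p^{\frac{n+1}{2-\gamma}}\}$ neurons in total, such that $\mathscr G-\mathscr N\in L^2(\mu;L^2([0,1]))$ and $$\|\mathscr G-\mathscr N\|_{L^2(\mu)}=\Big(\int\|\mathscr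 G(f)-\mathscr N(f)\|_{L^2([0,1])}^2\,d\mu(f)\Big)^{1/2}\le C\left(p^{-n}+e^{-\pi^2l^2K^2}+e^{-\pi^2l^2M^2}\right).$$ -/

import Mathlib

open MeasureTheory ProbabilityTheory Set
open scoped NNReal ENNReal ContDiff

noncomputable section

namespace SPP

/-! ### The spaces `L²([0,1])` and `H₀¹(0,1)` -/

/-- Lebesgue measure on `[0,1]`. -/
abbrev vol01 : Measure ℝ := volume.restrict (Icc (0 : ℝ) 1)

/-- The real Hilbert space `L²([0,1])`. -/
abbrev L2I : Type := Lp ℝ 2 vol01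

/-- `L²([0,1])` carries its Borel σ-algebra. -/
instance instMeasurableSpaceL2I : MeasurableSpace L2I := borel L2I

instance instBorelSpaceL2I : BorelSpace L2I := ⟨rfl⟩

/-- The graph of the weak derivative on `H₀¹(0,1)`: the pairs `(v, v')` with `v ∈ H₀¹(0,1)`, where
`H₀¹(0,1)` is the closure of `C_c^∞(0,1)` in the `H¹` norm, that is, with respect to `L²`
convergence of the functions together with their derivatives. -/
def H01 : Set (L2I × L2I) :=
  closure {w | ∃ φ : ℝ → ℝ, ContDiff ℝ ∞ φ ∧ HasCompactSupport φ ∧ tsupport φ ⊆ Ioo 0 1 ∧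
    (w.1 : ℝ → ℝ) =ᵐ[vol01] φ ∧ (w.2 : ℝ → ℝ) =ᵐ[vol01] deriv φ}

/-! ### The convection-diffusion problem `-ε u'' + a u' + c u = f`, `u(0) = u(1) = 0` -/

/-- `u ∈ H₀¹(0,1)` is a weak solution:
`ε ∫ u' v' + ∫ a u' v + ∫ c u v = ∫ f v` for all `v ∈ H₀¹(0,1)`. -/
def IsWeakSolution (ε : ℝ) (a c : ℝ → ℝ) (f u : L2I) : Prop :=
  ∃ du : L2I, (u, du) ∈ H01 ∧ ∀ v dv : L2I, (v, dv) ∈ H01 →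
    ε * (∫ x, du x * dv x ∂vol01) + (∫ x, a x * du x * v x ∂vol01)
      + (∫ x, c x * u x * v x ∂vol01) = ∫ x, f x * v x ∂vol01

/-- `G` is the solution operator `f ↦ u`: for each `f ∈ L²([0,1])`, `G f` is the one and only weak
solution. -/
def IsSolutionOperator (ε : ℝ) (a c : ℝ → ℝ) (G : L2I → L2I) : Prop :=
  ∀ f u : L2I, IsWeakSolution ε a c f u ↔ u = G f

/-! ### The Gaussian measure on the input space -/

/-- The periodization of the RBF kernel `exp (-|x - y|² / (2 l²))`. -/
def periodicRBF (l x y : ℝ) : ℝ := ∑' n : ℤ, Real.exp (-(x - y - n) ^ 2 / (2 * l ^ 2))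

/-- `μ` is the Gaussian measure `N(0, 𝒞)` on `L²([0,1])`, where `𝒞` is the integral operator with
kernel `periodicRBF l`: it is Gaussian and centred, and
`𝔼 ⟨g, f⟩ ⟨f, h⟩ = ⟨g, 𝒞 h⟩` for all `g, h ∈ L²([0,1])`. -/
structure IsPeriodicRBFGaussian (l : ℝ) (μ : Measure L2I) : Prop where
  isGaussian : IsGaussian μ
  mean_zero : ∫ f, f ∂μ = 0
  covariance : ∀ g h : L2I, ∫ f, inner ℝ g f * inner ℝ f h ∂μ =
    ∫ x, g x * (∫ y, periodicRBF l x y * h y ∂vol01) ∂vol01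

/-! ### ReLU networks -/

/-- A fully connected feed-forward ReLU network with input dimension `d₀` and output dimension
`d_L`: a chain of affine layers, each layer but the last being followed by ReLU. -/
inductive ReLUNet : ℕ → ℕ → Type
  | output {i o : ℕ} (W : Matrix (Fin o) (Fin i) ℝ) (b : Fin o → ℝ) : ReLUNet i o
  | hidden {i d o : ℕ} (W : Matrix (Fin d) (Fin i) ℝ) (b : Fin d → ℝ) (rest : ReLUNet d o) :
      ReLUNet i o

namespace ReLUNet

/-- The function computed by a network. -/
def eval : {i o : ℕ} → ReLUNet i o → (Fin i → ℝ) → (Fin o → ℝ)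
  | _, _, .output W b, x => W.mulVec x + b
  | _, _, .hidden W b rest, x => rest.eval fun k => max 0 ((W.mulVec x + b) k)

/-- The number of neurons in the hidden layers, `d₁ + ⋯ + d_{L-1}`. -/
def hiddenSize : {i o : ℕ} → ReLUNet i o → ℕ
  | _, _, .output _ _ => 0
  | _, _, .hidden (d := d) _ _ rest => d + rest.hiddenSize

/-- The number of all neurons, `d₀ + d₁ + ⋯ + d_L`. -/
def size {i o : ℕ} (N : ReLUNet i o) : ℕ := i + N.hiddenSize + o

theorem continuous_eval {i o : ℕ} (N : ReLUNet i o) : Continuous N.eval := by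
  induction N with
  | output W b =>
    show Continuous fun x => W.mulVec x + b
    fun_prop
  | hidden W b rest ih =>
    show Continuous fun x => rest.eval fun k => max 0 ((W.mulVec x + b) k)
    refine ih.comp (continuous_pi fun k => ?_)
    have h : Continuous fun x => W.mulVec x + b := by fun_prop
    exact continuous_const.max ((continuous_apply k).comp h)

end ReLUNet

/-! ### DeepONets -/

open Classical in
/-- The value at `x` of the continuous representative of `f ∈ L²([0,1])`, extended by `0` to those
`f` that have none. -/
def pointEval (f : L2I) (x : ℝ) : ℝ :=
  if h : ∃ g : ℝ → ℝ, Continuous g ∧ (f : ℝ → ℝ) =ᵐ[vol01] g then h.choose x else 0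

/-- The encoder `f ↦ (f(x₁), …, f(x_m))` at the equidistant points `x_j = j / m`, `j = 1, …, m`. -/
def encoder (m : ℕ) (f : L2I) : Fin m → ℝ := fun j => pointEval f (((j : ℕ) + 1 : ℝ) / m)

/-- The function `τ₀ + ∑ₖ αₖ τₖ` reconstructed from `α` by a trunk net `τ = (τ₀, τ₁, …, τ_p)`. -/
def reconstruct {p : ℕ} (τ : ReLUNet 1 (p + 1)) (α : Fin p → ℝ) (x : ℝ) : ℝ :=
  τ.eval (fun _ => x) 0 + ∑ k : Fin p, α k * τ.eval (fun _ => x) k.succ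

theorem continuous_reconstruct {p : ℕ} (τ : ReLUNet 1 (p + 1)) (α : Fin p → ℝ) :
    Continuous (reconstruct τ α) := by
  have h : Continuous fun x : ℝ => τ.eval fun _ => x :=
    τ.continuous_eval.comp (continuous_pi fun _ => continuous_id)
  have h' (k : Fin (p + 1)) : Continuous fun x : ℝ => τ.eval (fun _ => x) k :=
    (continuous_apply k).comp h
  exact (h' 0).add (continuous_finsetSum _ fun k _ => continuous_const.mul (h' k.succ))

theorem memLp_reconstruct {p : ℕ} (τ : ReLUNet 1 (p + 1)) (α : Fin p → ℝ) :
    MemLp (reconstruct τ α) 2 vol01 := by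
  obtain ⟨B, hB⟩ := isCompact_Icc.exists_bound_of_continuousOn
    (continuous_reconstruct τ α).continuousOn
  exact MemLp.of_bound (continuous_reconstruct τ α).aestronglyMeasurable B
    ((ae_restrict_iff' measurableSet_Icc).2 (Filter.Eventually.of_forall hB))

/-- The operator network `f ↦ τ₀ + ∑ₖ βₖ(f(x₁), …, f(x_m)) τₖ` with branch net `β` and trunk net
`τ`. -/
def deepONet {m p : ℕ} (β : ReLUNet m p) (τ : ReLUNet 1 (p + 1)) (f : L2I) : L2I :=
  (memLp_reconstruct τ (β.eval (encoder m f))).toLp (reconstruct τ (β.eval (encoder m f)))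

end SPP

end

/-! The Hartley functions `cas (2πkx)` form a real orthonormal basis of `L²([0,1])` that
diagonalizes the covariance, with Gaussian-decaying eigenvalues `λ_k`. Hence the coefficients of a
random `f` are uncorrelated with variance `λ_k`, and a random series `∑ ⟨h_k, f⟩ v_k` has mean
square norm `∑ λ_k ‖v_k‖²` (`IsPeriodicRBFGaussian.eLpNorm_sum`,
`IsPeriodicRBFGaussian.memLp_of_hasSum`).

The branch net is a single affine map, the discrete Hartley transform of the samples. By discrete
orthogonality it sends a frequency `k` to its alias modulo `m`, if that alias is retained. The error
is therefore such a random series, with `v_k = G h_k - aliasedTrunk k`. For `|k| ≤ min K M` there is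
no aliasing and `‖v_k‖` is just the trunk error `δ`; otherwise `‖v_k‖ ≤ 2Λ + δ`, and the tail of
`λ_k` supplies the two exponentials. Poisson summation bounds the trace `∑ λ_k` uniformly in `l ≤
l₀`. As the measure is centred and `G` linear, no bias function is needed and `τ₀ = 0`.

It remains to approximate the functions `G h_k`, `|k| ≤ K`, by one trunk net uniformly in `ε`. They
have a boundary layer at `x = 1`: `exists_second_derivative_bound` gives `|u''| ≲ p (1 + ε⁻² exp (-α
(1 - x) / ε))`, by a comparison principle for first-order equations applied in turn to `u`, `u'` and
`u''`. The only stability input is the `L²` bound `‖G h_k‖ ≤ Λ`, so no sign condition on `c` is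
required. A one-layer ReLU net interpolates all these functions on a common mesh graded towards the
layer, with error of order `p / N²` for `N` cells (`exists_trunk`). Taking `N = ⌈p ^ ((n + 1) / (2 -
γ))⌉` makes this `O (p ^ (-n))`. -/

namespace SPP

/-! ### The Hartley basis of `L²([0,1])` -/

/-- The Hartley function `cas (2πkx) = cos (2πkx) + sin (2πkx)`. -/
noncomputable def hartley (k : ℤ) (x : ℝ) : ℝ :=
  Real.cos (2 * Real.pi * k * x) + Real.sin (2 * Real.pi * k * x)

theorem continuous_hartley (k : ℤ) : Continuous (hartley k) := by
  unfold hartley; fun_prop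

theorem abs_hartley_le (k : ℤ) (x : ℝ) : |hartley k x| ≤ 2 := by
  have h1 := Real.abs_cos_le_one (2 * Real.pi * k * x)
  have h2 := Real.abs_sin_le_one (2 * Real.pi * k * x)
  exact (abs_add_le _ _).trans (by linarith)

theorem hasDerivAt_hartley (k : ℤ) (x : ℝ) :
    HasDerivAt (hartley k) (2 * Real.pi * k *
      (Real.cos (2 * Real.pi * k * x) - Real.sin (2 * Real.pi * k * x))) x := by
  have h : HasDerivAt (fun x : ℝ => 2 * Real.pi * k * x) (2 * Real.pi * k) x := by
    simpa using (hasDerivAt_id x).const_mul (2 * Real.pi * k)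
  have h2 := h.cos.add h.sin
  refine h2.congr_deriv ?_
  ring

theorem abs_deriv_hartley_le (k : ℤ) (x : ℝ) :
    |2 * Real.pi * k * (Real.cos (2 * Real.pi * k * x) - Real.sin (2 * Real.pi * k * x))|
      ≤ 4 * Real.pi * |(k : ℝ)| := by
  have h1 := Real.abs_cos_le_one (2 * Real.pi * k * x)
  have h2 := Real.abs_sin_le_one (2 * Real.pi * k * x)
  have h3 := abs_sub (Real.cos (2 * Real.pi * k * x)) (Real.sin (2 * Real.pi * k * x))
  rw [abs_mul, abs_mul, abs_of_pos Real.two_pi_pos]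
  have h4 : 0 ≤ 2 * Real.pi * |(k : ℝ)| := by positivity
  nlinarith

/-- Source of both orthogonality relations: the sine term vanishes under integration over a period
and under summation over the grid, and the cosine term only sees `j - k`. -/
theorem hartley_mul_hartley (j k : ℤ) (x : ℝ) :
    hartley j x * hartley k x = Real.cos (2 * Real.pi * (j - k : ℤ) * x)
      + Real.sin (2 * Real.pi * (j + k : ℤ) * x) := by
  unfold hartley
  have e1 : 2 * Real.pi * (j - k : ℤ) * x = 2 * Real.pi * j * x - 2 * Real.pi * k * x := by
    push_cast; ring
  have e2 : 2 * Real.pi * (j + k : ℤ) * x = 2 * Real.pi * j * x + 2 * Real.pi * k * x := by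
    push_cast; ring
  rw [e1, e2, Real.cos_sub, Real.sin_add]
  ring

theorem integral_vol01 (f : ℝ → ℝ) : ∫ x, f x ∂vol01 = ∫ x in (0 : ℝ)..1, f x := by
  rw [intervalIntegral.integral_of_le zero_le_one, integral_Icc_eq_integral_Ioc]

theorem integral_cos_two_pi_int (k : ℤ) :
    ∫ x in (0 : ℝ)..1, Real.cos (2 * Real.pi * k * x) = if k = 0 then 1 else 0 := by
  split_ifs with h
  · simp [h]
  · have h' : 2 * Real.pi * (k : ℝ) ≠ 0 := by
      have := Real.pi_ne_zero
      have : (k : ℝ) ≠ 0 := by exact_mod_cast h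
      positivity
    rw [intervalIntegral.integral_comp_mul_left (fun x => Real.cos x) h', integral_cos]
    have : Real.sin (2 * Real.pi * k * 1) = 0 := by
      have := Real.sin_int_mul_pi (2 * k)
      rw [← this]; congr 1; push_cast; ring
    rw [this]
    simp

theorem integral_sin_two_pi_int (k : ℤ) :
    ∫ x in (0 : ℝ)..1, Real.sin (2 * Real.pi * k * x) = 0 := by
  by_cases h : k = 0
  · simp [h]
  · have h' : 2 * Real.pi * (k : ℝ) ≠ 0 := by
      have := Real.pi_ne_zero
      have : (k : ℝ) ≠ 0 := by exact_mod_cast h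
      positivity
    rw [intervalIntegral.integral_comp_mul_left (fun x => Real.sin x) h', integral_sin]
    have : Real.cos (2 * Real.pi * k * 1) = 1 := by
      rw [mul_one, mul_comm, Real.cos_int_mul_two_pi]
    rw [this]
    simp

theorem integral_hartley_mul_hartley (j k : ℤ) :
    ∫ x, hartley j x * hartley k x ∂vol01 = if j = k then 1 else 0 := by
  simp_rw [hartley_mul_hartley]
  rw [integral_vol01, intervalIntegral.integral_add, integral_cos_two_pi_int,
    integral_sin_two_pi_int]
  · simp [sub_eq_zero]
  · exact Continuous.intervalIntegrable (by fun_prop) _ _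
  · exact Continuous.intervalIntegrable (by fun_prop) _ _

theorem memLp_of_continuous {g : ℝ → ℝ} (hg : Continuous g) : MemLp g 2 vol01 := by
  obtain ⟨B, hB⟩ := isCompact_Icc.exists_bound_of_continuousOn (s := Icc (0 : ℝ) 1)
    hg.continuousOn
  exact MemLp.of_bound hg.aestronglyMeasurable B
    ((ae_restrict_iff' measurableSet_Icc).2 (Filter.Eventually.of_forall hB))

/-- The Hartley function as an element of `L²([0,1])`. -/
noncomputable def hartleyLp (k : ℤ) : L2I := (memLp_of_continuous (continuous_hartley k)).toLp _

theorem coeFn_hartleyLp (k : ℤ) : (hartleyLp k : ℝ → ℝ) =ᵐ[vol01] hartley k :=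
  MemLp.coeFn_toLp _

theorem inner_L2I (f g : L2I) : inner ℝ f g = ∫ x, f x * g x ∂vol01 := by
  rw [L2.inner_def]
  refine integral_congr_ae (Filter.Eventually.of_forall fun x => ?_)
  simp [mul_comm]

theorem inner_hartleyLp (k : ℤ) (f : L2I) :
    inner ℝ (hartleyLp k) f = ∫ x, hartley k x * f x ∂vol01 := by
  rw [inner_L2I]
  refine integral_congr_ae ?_
  filter_upwards [coeFn_hartleyLp k] with x hx
  rw [hx]

theorem orthonormal_hartleyLp : Orthonormal ℝ hartleyLp := by
  rw [orthonormal_iff_ite]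
  intro i j
  rw [inner_hartleyLp, ← integral_hartley_mul_hartley]
  refine integral_congr_ae ?_
  filter_upwards [coeFn_hartleyLp j] with x hx
  rw [hx]

instance : IsProbabilityMeasure vol01 := ⟨by simp⟩

theorem integrable_continuous_mul {g : ℝ → ℝ} (hg : Continuous g) (f : L2I) :
    Integrable (fun x => g x * f x) vol01 :=
  (memLp_of_continuous hg).integrable_mul (Lp.memLp f)

/-- The half sum and half difference of the coefficients at `k` and `-k` are the cosine and sine
coefficients. So all complex Fourier coefficients vanish, and Parseval applies. -/
theorem eq_zero_of_inner_hartleyLp (f : L2I) (hf : ∀ k, inner ℝ (hartleyLp k) f = 0) : f = 0 := by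
  have hI (k : ℤ) : ∫ x, hartley k x * f x ∂vol01 = 0 := by rw [← inner_hartleyLp, hf]
  have hcs (k : ℤ) : ∫ x, Real.cos (2 * Real.pi * k * x) * f x ∂vol01 = 0 ∧
      ∫ x, Real.sin (2 * Real.pi * k * x) * f x ∂vol01 = 0 := by
    have i1 := integrable_continuous_mul
      (g := fun x => Real.cos (2 * Real.pi * k * x)) (by fun_prop) f
    have i2 := integrable_continuous_mul
      (g := fun x => Real.sin (2 * Real.pi * k * x)) (by fun_prop) f
    have h1 := hI k
    have h2 := hI (-k)
    have e1 : (fun x => hartley k x * f x) = fun x =>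
        Real.cos (2 * Real.pi * k * x) * f x + Real.sin (2 * Real.pi * k * x) * f x := by
      funext x; unfold hartley; ring
    have e2 : (fun x => hartley (-k) x * f x) = fun x =>
        Real.cos (2 * Real.pi * k * x) * f x - Real.sin (2 * Real.pi * k * x) * f x := by
      funext x; unfold hartley
      have : 2 * Real.pi * ((-k : ℤ) : ℝ) * x = -(2 * Real.pi * k * x) := by push_cast; ring
      rw [this, Real.cos_neg, Real.sin_neg]; ring
    rw [e1, integral_add i1 i2] at h1
    rw [e2, integral_sub i1 i2] at h2
    constructor <;> linarith
  have hmem : MemLp (fun x => (f x : ℂ)) 2 (volume.restrict (Ioc (0 : ℝ) 1)) := by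
    have := (Lp.memLp f).ofReal (K := ℂ)
    exact (restrict_Ioc_eq_restrict_Icc (μ := volume) (a := (0 : ℝ)) (b := 1)) ▸ this
  have hcoef (k : ℤ) : fourierCoeffOn zero_lt_one (fun x => (f x : ℂ)) k = 0 := by
    rw [fourierCoeffOn_eq_integral]
    rw [intervalIntegral.integral_of_le zero_le_one, ← integral_Icc_eq_integral_Ioc]
    have e (x : ℝ) : (fourier (-k) (x : AddCircle ((1 : ℝ) - 0))) • (f x : ℂ) =
        ((Real.cos (2 * Real.pi * k * x) * f x : ℝ) : ℂ)
          - Complex.I * ((Real.sin (2 * Real.pi * k * x) * f x : ℝ) : ℂ) := by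
      rw [fourier_coe_apply]
      have : 2 * (Real.pi : ℂ) * Complex.I * ((-k : ℤ) : ℂ) * x / ((1 - 0 : ℝ) : ℂ) =
          ((-(2 * Real.pi * k * x) : ℝ) : ℂ) * Complex.I := by push_cast; ring
      rw [this, Complex.exp_mul_I, ← Complex.ofReal_cos, ← Complex.ofReal_sin, Real.cos_neg,
        Real.sin_neg, smul_eq_mul]
      push_cast; ring
    simp_rw [e]
    have i1 := integrable_continuous_mul
      (g := fun x => Real.cos (2 * Real.pi * k * x)) (by fun_prop) f
    have i2 := integrable_continuous_mul
      (g := fun x => Real.sin (2 * Real.pi * k * x)) (by fun_prop) f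
    rw [integral_sub i1.ofReal (i2.ofReal.const_mul _), integral_const_mul]
    rw [integral_complex_ofReal, integral_complex_ofReal, (hcs k).1, (hcs k).2]
    simp
  have hsum := hasSum_sq_fourierCoeffOn zero_lt_one hmem
  simp only [hcoef, norm_zero, ne_eq, OfNat.ofNat_ne_zero, not_false_eq_true, zero_pow] at hsum
  have h0 := hsum.unique hasSum_zero
  rw [← inner_self_eq_zero (𝕜 := ℝ), inner_L2I, integral_vol01]
  simpa [sq] using h0

/-- The Hartley functions as a Hilbert basis. -/
noncomputable def hartleyBasis : HilbertBasis ℤ ℝ L2I :=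
  HilbertBasis.mkOfOrthogonalEqBot orthonormal_hartleyLp <| by
    rw [Submodule.eq_bot_iff]
    intro f hf
    refine eq_zero_of_inner_hartleyLp f fun k => ?_
    exact (Submodule.mem_orthogonal _ _).1 hf _ (Submodule.subset_span ⟨k, rfl⟩)

theorem hasSum_inner_hartleyLp (f : L2I) :
    HasSum (fun k => (inner ℝ (hartleyLp k) f : ℝ) • hartleyLp k) f := by
  have h := hartleyBasis.hasSum_repr f
  simpa [HilbertBasis.repr_apply_apply, hartleyBasis] using h

theorem norm_hartleyLp (k : ℤ) : ‖hartleyLp k‖ = 1 := orthonormal_hartleyLp.1 k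

/-! ### Discrete orthogonality on the equidistant grid -/

theorem sum_grid_exp (k : ℤ) {m : ℕ} (hm : m ≠ 0) :
    ∑ i : Fin m, Complex.exp (((2 * Real.pi * k * (((i : ℕ) + 1 : ℝ) / m) : ℝ) : ℂ) * Complex.I)
      = if (m : ℤ) ∣ k then (m : ℂ) else 0 := by
  have hm' : (m : ℂ) ≠ 0 := by exact_mod_cast hm
  have hζ := Complex.isPrimitiveRoot_exp m hm
  set ζ := Complex.exp (2 * Real.pi * Complex.I / m)
  have e (i : Fin m) :
      Complex.exp (((2 * Real.pi * k * (((i : ℕ) + 1 : ℝ) / m) : ℝ) : ℂ) * Complex.I)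
        = ζ ^ k * (ζ ^ k) ^ (i : ℕ) := by
    rw [← pow_succ', ← zpow_natCast, ← zpow_mul, ← Complex.exp_int_mul]
    congr 1; push_cast; ring
  simp_rw [e]
  rw [← Finset.mul_sum, Fin.sum_univ_eq_sum_range (fun i => (ζ ^ k) ^ i) m]
  split_ifs with h
  · rw [(hζ.zpow_eq_one_iff_dvd k).2 h]; simp
  · have h1 : ζ ^ k ≠ 1 := fun h' => h ((hζ.zpow_eq_one_iff_dvd k).1 h')
    have h2 : (ζ ^ k) ^ m = 1 := by
      rw [← zpow_natCast, ← zpow_mul, mul_comm, zpow_mul, zpow_natCast, hζ.pow_eq_one, one_zpow]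
    rw [geom_sum_eq h1, h2]; simp

theorem sum_grid_hartley_mul_hartley (j k : ℤ) {m : ℕ} (hm : m ≠ 0) :
    ∑ i : Fin m, hartley j (((i : ℕ) + 1 : ℝ) / m) * hartley k (((i : ℕ) + 1 : ℝ) / m)
      = if (m : ℤ) ∣ j - k then (m : ℝ) else 0 := by
  simp_rw [hartley_mul_hartley]
  have hre (k : ℤ) : ∑ i : Fin m, Real.cos (2 * Real.pi * k * (((i : ℕ) + 1 : ℝ) / m))
      = if (m : ℤ) ∣ k then (m : ℝ) else 0 := by
    have := congrArg Complex.re (sum_grid_exp k hm)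
    simp_rw [Complex.re_sum, Complex.exp_ofReal_mul_I_re] at this
    rw [this]; split_ifs <;> simp
  have him (k : ℤ) : ∑ i : Fin m, Real.sin (2 * Real.pi * k * (((i : ℕ) + 1 : ℝ) / m)) = 0 := by
    have := congrArg Complex.im (sum_grid_exp k hm)
    simp_rw [Complex.im_sum, Complex.exp_ofReal_mul_I_im] at this
    rw [this]; split_ifs <;> simp
  rw [Finset.sum_add_distrib, hre, him, add_zero]

/-! ### The spectrum of the covariance operator -/

/-- The eigenvalue `√(2π) l exp (-2π²l²k²)` of the periodized RBF kernel. -/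
noncomputable def rbfEigenvalue (l : ℝ) (k : ℤ) : ℝ :=
  √(2 * Real.pi) * l * Real.exp (-(2 * Real.pi ^ 2 * l ^ 2 * (k : ℝ) ^ 2))

theorem rbfEigenvalue_nonneg {l : ℝ} (hl : 0 < l) (k : ℤ) : 0 ≤ rbfEigenvalue l k := by
  unfold rbfEigenvalue; positivity

theorem integral_gaussian_trig {b : ℝ} (hb : 0 < b) (t : ℝ) :
    (∫ x : ℝ, Real.exp (-b * x ^ 2) * Real.cos (t * x) =
      √(Real.pi / b) * Real.exp (-t ^ 2 / (4 * b))) ∧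
    ∫ x : ℝ, Real.exp (-b * x ^ 2) * Real.sin (t * x) = 0 := by
  have h := fourierIntegral_gaussian (b := (b : ℂ)) (by simpa using hb) (t : ℂ)
  have e (x : ℝ) : Complex.exp (Complex.I * t * x) * Complex.exp (-(b : ℂ) * x ^ 2) =
      ((Real.exp (-b * x ^ 2) * Real.cos (t * x) : ℝ) : ℂ)
        + ((Real.exp (-b * x ^ 2) * Real.sin (t * x) : ℝ) : ℂ) * Complex.I := by
    have h1 : Complex.I * t * x = ((t * x : ℝ) : ℂ) * Complex.I := by push_cast; ring
    have h2 : -(b : ℂ) * (x : ℂ) ^ 2 = ((-b * x ^ 2 : ℝ) : ℂ) := by push_cast; ring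
    rw [h1, h2, Complex.exp_mul_I, ← Complex.ofReal_cos, ← Complex.ofReal_sin,
      ← Complex.ofReal_exp]
    push_cast; ring
  have hint : Integrable fun x : ℝ => Real.exp (-b * x ^ 2) := integrable_exp_neg_mul_sq hb
  have i1 : Integrable fun x : ℝ => Real.exp (-b * x ^ 2) * Real.cos (t * x) :=
    hint.mul_bdd (c := 1) (by fun_prop)
      (Filter.Eventually.of_forall fun x => by simpa using Real.abs_cos_le_one _)
  have i2 : Integrable fun x : ℝ => Real.exp (-b * x ^ 2) * Real.sin (t * x) :=
    hint.mul_bdd (c := 1) (by fun_prop)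
      (Filter.Eventually.of_forall fun x => by simpa using Real.abs_sin_le_one _)
  have hr : ((Real.pi : ℂ) / b) ^ (1 / 2 : ℂ) * Complex.exp (-(t : ℂ) ^ 2 / (4 * b)) =
      ((√(Real.pi / b) * Real.exp (-t ^ 2 / (4 * b)) : ℝ) : ℂ) := by
    rw [Real.sqrt_eq_rpow]
    push_cast [Complex.ofReal_cpow (show 0 ≤ Real.pi / b by positivity)]
    rfl
  simp_rw [e] at h
  rw [integral_add i1.ofReal (i2.ofReal.mul_const _), integral_mul_const, hr,
    integral_complex_ofReal, integral_complex_ofReal] at h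
  have hre := congrArg Complex.re h
  have him := congrArg Complex.im h
  simp only [Complex.add_re, Complex.add_im, Complex.mul_re,
    Complex.mul_im, Complex.ofReal_re, Complex.ofReal_im, Complex.I_re, Complex.I_im,
    mul_zero, mul_one, add_zero, zero_add, sub_self] at hre him
  exact ⟨hre, him⟩

/-- Convolution with an even kernel: the sine transform of the Gaussian is zero, so the addition
formulas leave a multiple of `hartley k`. -/
theorem integral_gaussian_mul_hartley {l : ℝ} (hl : 0 < l) (k : ℤ) (x : ℝ) :
    ∫ y : ℝ, Real.exp (-(x - y) ^ 2 / (2 * l ^ 2)) * hartley k y =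
      rbfEigenvalue l k * hartley k x := by
  have hb : 0 < 1 / (2 * l ^ 2) := by positivity
  obtain ⟨hc, hs⟩ := integral_gaussian_trig hb (2 * Real.pi * k)
  have hint : Integrable fun x : ℝ => Real.exp (-(1 / (2 * l ^ 2)) * x ^ 2) :=
    integrable_exp_neg_mul_sq hb
  have i1 : Integrable fun x : ℝ =>
      Real.exp (-(1 / (2 * l ^ 2)) * x ^ 2) * Real.cos (2 * Real.pi * k * x) :=
    hint.mul_bdd (c := 1) (by fun_prop)
      (Filter.Eventually.of_forall fun x => by simpa using Real.abs_cos_le_one _)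
  have i2 : Integrable fun x : ℝ =>
      Real.exp (-(1 / (2 * l ^ 2)) * x ^ 2) * Real.sin (2 * Real.pi * k * x) :=
    hint.mul_bdd (c := 1) (by fun_prop)
      (Filter.Eventually.of_forall fun x => by simpa using Real.abs_sin_le_one _)
  rw [← integral_sub_left_eq_self _ volume x]
  have e (y : ℝ) : Real.exp (-(x - (x - y)) ^ 2 / (2 * l ^ 2)) * hartley k (x - y) =
      Real.exp (-(1 / (2 * l ^ 2)) * y ^ 2) * Real.cos (2 * Real.pi * k * y) * hartley k x +
      Real.exp (-(1 / (2 * l ^ 2)) * y ^ 2) * Real.sin (2 * Real.pi * k * y) *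
        (Real.sin (2 * Real.pi * k * x) - Real.cos (2 * Real.pi * k * x)) := by
    have e1 : -(x - (x - y)) ^ 2 / (2 * l ^ 2) = -(1 / (2 * l ^ 2)) * y ^ 2 := by ring
    have e2 : 2 * Real.pi * k * (x - y) = 2 * Real.pi * k * x - 2 * Real.pi * k * y := by ring
    unfold hartley
    rw [e1, e2, Real.cos_sub, Real.sin_sub]
    ring
  simp_rw [e]
  rw [integral_add (i1.mul_const _) (i2.mul_const _), integral_mul_const, integral_mul_const,
    hc, hs, zero_mul, add_zero]
  congr 1
  unfold rbfEigenvalue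
  have e1 : Real.pi / (1 / (2 * l ^ 2)) = 2 * Real.pi * l ^ 2 := by field_simp
  rw [e1, Real.sqrt_mul (by positivity), Real.sqrt_sq hl.le]
  congr 2
  field_simp
  ring

theorem hartley_add_int (k n : ℤ) (x : ℝ) : hartley k (x + n) = hartley k x := by
  have e : 2 * Real.pi * k * (x + n) = 2 * Real.pi * k * x + (k * n : ℤ) * (2 * Real.pi) := by
    push_cast; ring
  unfold hartley
  rw [e, Real.cos_add_int_mul_two_pi, Real.sin_add_int_mul_two_pi]

/-- Unfolding: since `hartley k` has period one, the integral of the periodized kernel over a period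
is that of the Gaussian over the whole line. -/
theorem integral_periodicRBF_mul_hartley {l : ℝ} (hl : 0 < l) (k : ℤ) (x : ℝ) :
    ∫ y, periodicRBF l x y * hartley k y ∂vol01 = rbfEigenvalue l k * hartley k x := by
  have hint : Integrable fun y : ℝ => Real.exp (-(x - y) ^ 2 / (2 * l ^ 2)) * hartley k y := by
    have hb : 0 < 1 / (2 * l ^ 2) := by positivity
    have h := (integrable_exp_neg_mul_sq hb).comp_sub_left x
    have h' : Integrable fun y : ℝ => Real.exp (-(x - y) ^ 2 / (2 * l ^ 2)) := by
      refine h.congr (Filter.Eventually.of_forall fun y => ?_)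
      simp only
      congr 1; ring
    exact h'.mul_bdd (c := 2) (continuous_hartley k).aestronglyMeasurable
      (Filter.Eventually.of_forall fun y => abs_hartley_le k y)
  have e (n : ℤ) (y : ℝ) :
      Real.exp (-(x - (y + n)) ^ 2 / (2 * l ^ 2)) * hartley k (y + n) =
        Real.exp (-(x - y - n) ^ 2 / (2 * l ^ 2)) * hartley k y := by
    rw [hartley_add_int, sub_add_eq_sub_sub]
  have h1 := hint.hasSum_intervalIntegral_comp_add_int
  have h2 := hint.norm.hasSum_intervalIntegral_comp_add_int
  simp_rw [e] at h1 h2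
  rw [integral_gaussian_mul_hartley hl] at h1
  simp_rw [← integral_vol01] at h1 h2
  have h3 := hasSum_integral_of_summable_integral_norm (μ := vol01)
    (F := fun (n : ℤ) y => Real.exp (-(x - y - n) ^ 2 / (2 * l ^ 2)) * hartley k y)
    (fun n => (Continuous.integrableOn_Icc (by have := continuous_hartley k; fun_prop)))
    h2.summable
  rw [h3.unique h1 |>.symm]
  refine integral_congr_ae (Filter.Eventually.of_forall fun y => ?_)
  simp only [periodicRBF, tsum_mul_right]

/-! ### Summing the eigenvalues -/

theorem summable_exp_neg_mul_int_sq {b : ℝ} (hb : 0 < b) :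
    Summable fun n : ℤ => Real.exp (-(b * (n : ℝ) ^ 2)) := by
  have h (n : ℕ) : Real.exp (-(b * (n : ℝ) ^ 2)) ≤ Real.exp (n * (-b)) := by
    rw [Real.exp_le_exp]
    have : (n : ℝ) ≤ (n : ℝ) ^ 2 := by exact_mod_cast Nat.le_self_pow two_ne_zero n
    nlinarith
  have hs : Summable fun n : ℕ => Real.exp (-(b * (n : ℝ) ^ 2)) :=
    Summable.of_nonneg_of_le (fun n => (Real.exp_pos _).le) h
      (Real.summable_exp_nat_mul_iff.2 (by linarith))
  refine Summable.of_nat_of_neg ?_ ?_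
  · simpa using hs
  · simpa using hs

theorem summable_rbfEigenvalue {l : ℝ} (hl : 0 < l) : Summable (rbfEigenvalue l) :=
  (summable_exp_neg_mul_int_sq (b := 2 * Real.pi ^ 2 * l ^ 2) (by positivity)).mul_left _

theorem summable_sqrt_rbfEigenvalue {l : ℝ} (hl : 0 < l) :
    Summable fun k => √(rbfEigenvalue l k) := by
  have h := (summable_exp_neg_mul_int_sq (b := Real.pi ^ 2 * l ^ 2) (by positivity)).mul_left
    (√(√(2 * Real.pi) * l))
  refine h.congr fun k => ?_
  unfold rbfEigenvalue
  rw [Real.sqrt_mul (x := √(2 * Real.pi) * l) (by positivity), ← Real.exp_half]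
  congr 2
  ring

/-- Poisson summation. The right-hand side is increasing in `l`, which gives a trace bound uniform
on `(0, l₀]`, although the eigenvalues decay arbitrarily slowly as `l → 0`. -/
theorem tsum_rbfEigenvalue {l : ℝ} (hl : 0 < l) :
    ∑' k, rbfEigenvalue l k = ∑' n : ℤ, Real.exp (-(1 / (2 * l ^ 2) * (n : ℝ) ^ 2)) := by
  have h := Real.tsum_exp_neg_mul_int_sq (a := 2 * Real.pi * l ^ 2) (by positivity)
  unfold rbfEigenvalue
  rw [tsum_mul_left]
  have e1 (n : ℤ) : -(2 * Real.pi ^ 2 * l ^ 2 * (n : ℝ) ^ 2) =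
    -Real.pi * (2 * Real.pi * l ^ 2) * (n : ℝ) ^ 2 := by ring
  have e2 (n : ℤ) : -(1 / (2 * l ^ 2) * (n : ℝ) ^ 2) =
    -Real.pi / (2 * Real.pi * l ^ 2) * (n : ℝ) ^ 2 := by
    have := Real.pi_ne_zero
    field_simp
  simp_rw [e1, e2]
  rw [h, ← Real.sqrt_eq_rpow, Real.sqrt_mul (x := 2 * Real.pi) (by positivity),
    Real.sqrt_sq hl.le]
  have : √(2 * Real.pi) * l ≠ 0 := by positivity
  field_simp

/-- A bound for the trace of the covariance that is uniform in `l ∈ (0, l₀]`. -/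
noncomputable def traceBound (l₀ : ℝ) : ℝ := ∑' n : ℤ, Real.exp (-(1 / (2 * l₀ ^ 2) * (n : ℝ) ^ 2))

theorem tsum_rbfEigenvalue_le {l l₀ : ℝ} (hl : 0 < l) (hl₀ : l ≤ l₀) :
    ∑' k, rbfEigenvalue l k ≤ traceBound l₀ := by
  have h0 : 0 < l₀ := hl.trans_le hl₀
  rw [tsum_rbfEigenvalue hl]
  refine Summable.tsum_le_tsum (fun n => ?_) (summable_exp_neg_mul_int_sq (by positivity))
    (summable_exp_neg_mul_int_sq (by positivity))
  rw [Real.exp_le_exp, neg_le_neg_iff]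
  gcongr

theorem traceBound_nonneg (l₀ : ℝ) : 0 ≤ traceBound l₀ := tsum_nonneg fun _ => (Real.exp_pos _).le

/-- For `|k| > N` one has `k² ≥ N² + (|k| - N)²`, so a tail eigenvalue is a small factor times a
shifted eigenvalue. Keeping both shifts covers both signs of `k`, and the tail is then controlled by
the trace with no further dependence on `l`. -/
theorem rbfEigenvalue_le_of_lt_abs {l : ℝ} (hl : 0 < l) {N : ℕ} {k : ℤ} (hk : (N : ℤ) < |k|) :
    rbfEigenvalue l k ≤ Real.exp (-(2 * Real.pi ^ 2 * l ^ 2 * (N : ℝ) ^ 2)) *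
      (rbfEigenvalue l (k - N) + rbfEigenvalue l (k + N)) := by
  have key (j : ℤ) (h : (N : ℝ) ^ 2 + (j : ℝ) ^ 2 ≤ (k : ℝ) ^ 2) : rbfEigenvalue l k ≤
      Real.exp (-(2 * Real.pi ^ 2 * l ^ 2 * (N : ℝ) ^ 2)) * rbfEigenvalue l j := by
    unfold rbfEigenvalue
    rw [mul_left_comm, ← Real.exp_add]
    gcongr
    have : 0 ≤ 2 * Real.pi ^ 2 * l ^ 2 := by positivity
    nlinarith
  have hn (j : ℤ) : 0 ≤ Real.exp (-(2 * Real.pi ^ 2 * l ^ 2 * (N : ℝ) ^ 2)) * rbfEigenvalue l j :=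
    mul_nonneg (Real.exp_pos _).le (rbfEigenvalue_nonneg hl j)
  have hN : (0 : ℤ) ≤ N := by positivity
  rw [mul_add]
  rcases lt_abs.1 hk with h | h
  · have := key (k - N) (by
      have : (N : ℤ) ^ 2 + (k - N) ^ 2 ≤ k ^ 2 := by nlinarith
      exact_mod_cast this)
    linarith [hn (k + N)]
  · have := key (k + N) (by
      have : (N : ℤ) ^ 2 + (k + N) ^ 2 ≤ k ^ 2 := by nlinarith
      exact_mod_cast this)
    linarith [hn (k - N)]

/-- If `b ≤ δ` on `|k| ≤ N` and `b ≤ D` elsewhere then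
`∑ λ_k b_k² ≤ (δ² + 2 D² exp (-2π²l²N²)) tr 𝒞`. -/
theorem sum_rbfEigenvalue_mul_sq_le {l l₀ : ℝ} (hl : 0 < l) (hl₀ : l ≤ l₀) {b : ℤ → ℝ} {δ D : ℝ}
    {N : ℕ} (hb : ∀ k, 0 ≤ b k) (hδ : ∀ k : ℤ, |k| ≤ N → b k ≤ δ) (hD : ∀ k, b k ≤ D)
    (s : Finset ℤ) :
    ∑ k ∈ s, rbfEigenvalue l k * b k ^ 2 ≤
      (δ ^ 2 + 2 * D ^ 2 * Real.exp (-(2 * Real.pi ^ 2 * l ^ 2 * (N : ℝ) ^ 2))) *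
        traceBound l₀ := by
  set E := Real.exp (-(2 * Real.pi ^ 2 * l ^ 2 * (N : ℝ) ^ 2))
  have hE : 0 < E := Real.exp_pos _
  have hlam := rbfEigenvalue_nonneg hl
  have hsum (j : ℤ) : ∑ k ∈ s, rbfEigenvalue l (k + j) ≤ traceBound l₀ := by
    refine le_trans ?_ (tsum_rbfEigenvalue_le hl hl₀)
    have hs := (Equiv.addRight j).summable_iff.2 (summable_rbfEigenvalue hl)
    have ht := (Equiv.addRight j).tsum_eq (rbfEigenvalue l)
    rw [← ht]
    exact hs.sum_le_tsum s fun k _ => hlam _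
  calc ∑ k ∈ s, rbfEigenvalue l k * b k ^ 2
      ≤ ∑ k ∈ s, (δ ^ 2 * rbfEigenvalue l (k + 0) +
          D ^ 2 * E * (rbfEigenvalue l (k + -N) + rbfEigenvalue l (k + N))) := by
        refine Finset.sum_le_sum fun k _ => ?_
        have h1 := hlam k
        have h2 : 0 ≤ rbfEigenvalue l (k + -N) + rbfEigenvalue l (k + N) :=
          add_nonneg (hlam _) (hlam _)
        rw [add_zero]
        by_cases hk : |k| ≤ N
        · have : b k ^ 2 ≤ δ ^ 2 := pow_le_pow_left₀ (hb k) (hδ k hk) 2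
          have h3 : 0 ≤ D ^ 2 * E * (rbfEigenvalue l (k + -N) + rbfEigenvalue l (k + N)) := by
            positivity
          nlinarith
        · have h4 := rbfEigenvalue_le_of_lt_abs hl (not_le.1 hk)
          have h5 : b k ^ 2 ≤ D ^ 2 := pow_le_pow_left₀ (hb k) (hD k) 2
          have h6 : 0 ≤ δ ^ 2 * rbfEigenvalue l k := by positivity
          rw [sub_eq_add_neg] at h4
          calc rbfEigenvalue l k * b k ^ 2 ≤ rbfEigenvalue l k * D ^ 2 := by gcongr
            _ ≤ (E * (rbfEigenvalue l (k + -N) + rbfEigenvalue l (k + N))) * D ^ 2 := by gcongr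
            _ ≤ _ := by linarith
    _ = δ ^ 2 * ∑ k ∈ s, rbfEigenvalue l (k + 0) + D ^ 2 * E *
          (∑ k ∈ s, rbfEigenvalue l (k + -N) + ∑ k ∈ s, rbfEigenvalue l (k + N)) := by
        rw [Finset.sum_add_distrib, ← Finset.mul_sum, ← Finset.mul_sum, Finset.sum_add_distrib]
    _ ≤ δ ^ 2 * traceBound l₀ + D ^ 2 * E * (traceBound l₀ + traceBound l₀) := by
        gcongr <;> exact hsum _
    _ = _ := by ring

/-! ### The Fourier coefficients of a Gaussian random function -/

instance : SecondCountableTopology L2I := by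
  have : Fact ((2 : ℝ≥0∞) ≠ ⊤) := ⟨by norm_num⟩
  have : TopologicalSpace.SeparableSpace L2I := inferInstance
  exact UniformSpace.secondCountable_of_separable _

section Gaussian

variable {l : ℝ} {μ : Measure L2I}

theorem IsPeriodicRBFGaussian.memLp_inner (hμ : IsPeriodicRBFGaussian l μ) (g : L2I) :
    MemLp (fun f : L2I => inner ℝ g f) 2 μ := by
  have := hμ.isGaussian
  exact (IsGaussian.memLp_two_id (μ := μ)).const_inner g

theorem IsPeriodicRBFGaussian.integral_inner_mul_inner (hl : 0 < l)
    (hμ : IsPeriodicRBFGaussian l μ) (j k : ℤ) :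
    ∫ f, inner ℝ (hartleyLp j) f * inner ℝ (hartleyLp k) f ∂μ =
      if j = k then rbfEigenvalue l k else 0 := by
  have h := hμ.covariance (hartleyLp j) (hartleyLp k)
  simp_rw [fun f : L2I => real_inner_comm (hartleyLp k) f] at h
  have e (x : ℝ) : ∫ y, periodicRBF l x y * hartleyLp k y ∂vol01 =
      rbfEigenvalue l k * hartley k x := by
    rw [← integral_periodicRBF_mul_hartley hl]
    refine integral_congr_ae ?_
    filter_upwards [coeFn_hartleyLp k] with y hy
    rw [hy]
  simp_rw [e] at h
  rw [h]
  have e2 : ∫ x, hartleyLp j x * (rbfEigenvalue l k * hartley k x) ∂vol01 =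
      rbfEigenvalue l k * ∫ x, hartley j x * hartley k x ∂vol01 := by
    rw [← integral_const_mul]
    refine integral_congr_ae ?_
    filter_upwards [coeFn_hartleyLp j] with y hy
    rw [hy]; ring
  rw [e2, integral_hartley_mul_hartley]
  simp

theorem IsPeriodicRBFGaussian.eLpNorm_inner (hl : 0 < l) (hμ : IsPeriodicRBFGaussian l μ) (k : ℤ) :
    eLpNorm (fun f : L2I => inner ℝ (hartleyLp k) f) 2 μ =
      ENNReal.ofReal (√(rbfEigenvalue l k)) := by
  rw [(hμ.memLp_inner _).eLpNorm_eq_integral_rpow_norm (by norm_num) (by norm_num),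
    Real.sqrt_eq_rpow]
  have h := hμ.integral_inner_mul_inner hl k k
  simp only [if_true] at h
  rw [← h]
  simp [← sq]

/-- First absolute moments are at most `√λ_k`, which is still summable. Almost sure absolute
summability is what gives sampling at points a meaning. -/
theorem IsPeriodicRBFGaussian.ae_summable_abs_inner (hl : 0 < l)
    (hμ : IsPeriodicRBFGaussian l μ) :
    ∀ᵐ f ∂μ, Summable fun k => |inner ℝ (hartleyLp k) f| := by
  have := hμ.isGaussian
  have hm (k : ℤ) : AEMeasurable (fun f : L2I => ‖(inner ℝ (hartleyLp k) f : ℝ)‖ₑ) μ :=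
    (hμ.memLp_inner _).1.enorm
  have h : ∫⁻ f, ∑' k : ℤ, ‖(inner ℝ (hartleyLp k) f : ℝ)‖ₑ ∂μ ≠ ⊤ := by
    rw [lintegral_tsum hm]
    have hle (k : ℤ) : ∫⁻ f, ‖(inner ℝ (hartleyLp k) f : ℝ)‖ₑ ∂μ ≤
        ENNReal.ofReal (√(rbfEigenvalue l k)) := by
      rw [← hμ.eLpNorm_inner hl, ← eLpNorm_one_eq_lintegral_enorm]
      exact eLpNorm_le_eLpNorm_of_exponent_le (by norm_num) (hμ.memLp_inner _).1
    refine ne_top_of_le_ne_top ?_ (ENNReal.tsum_le_tsum hle)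
    rw [← ENNReal.ofReal_tsum_of_nonneg (fun _ => Real.sqrt_nonneg _)
      (summable_sqrt_rbfEigenvalue hl)]
    exact ENNReal.ofReal_ne_top
  filter_upwards [ae_lt_top' (AEMeasurable.tsum hm) h] with f hf
  simpa using ENNReal.summable_toReal hf.ne

end Gaussian

/-! ### Point evaluations of functions with summable Fourier coefficients -/

/-- The Hartley function as a bounded continuous function. -/
noncomputable def hartleyBCF (k : ℤ) : BoundedContinuousFunction ℝ ℝ :=
  BoundedContinuousFunction.ofNormedAddCommGroup (hartley k) (continuous_hartley k) 2
    (abs_hartley_le k)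

theorem toLp_hartleyBCF (k : ℤ) :
    BoundedContinuousFunction.toLp 2 vol01 ℝ (hartleyBCF k) = hartleyLp k := by
  refine Lp.ext ?_
  filter_upwards [coeFn_hartleyLp k,
    BoundedContinuousFunction.coeFn_toLp 2 vol01 ℝ (hartleyBCF k)] with x h1 h2
  rw [h1, h2]; rfl

/-- The series converges uniformly to a continuous function that represents `f`. Any two continuous
representatives agree on all of `[0,1]`, so the choice made in `pointEval` is immaterial there. -/
theorem hasSum_pointEval {f : L2I} (hf : Summable fun k => |inner ℝ (hartleyLp k) f|) {x : ℝ}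
    (hx : x ∈ Icc (0 : ℝ) 1) :
    HasSum (fun k => (inner ℝ (hartleyLp k) f : ℝ) * hartley k x) (pointEval f x) := by
  have hs : Summable fun k => (inner ℝ (hartleyLp k) f : ℝ) • hartleyBCF k := by
    refine Summable.of_norm_bounded (hf.mul_right 2) fun k => ?_
    rw [norm_smul]
    gcongr
    · rfl
    · exact BoundedContinuousFunction.norm_ofNormedAddCommGroup_le _ (by norm_num) _
  obtain ⟨g, hg⟩ := hs
  have h1 := (BoundedContinuousFunction.toLp (E := ℝ) 2 vol01 ℝ).hasSum hg
  simp only [map_smul, toLp_hartleyBCF] at h1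
  have h2 : f = BoundedContinuousFunction.toLp 2 vol01 ℝ g :=
    (hasSum_inner_hartleyLp f).unique h1
  have h3 : (f : ℝ → ℝ) =ᵐ[vol01] g := by
    conv_lhs => rw [h2]
    exact BoundedContinuousFunction.coeFn_toLp 2 vol01 ℝ g
  have hex : ∃ g : ℝ → ℝ, Continuous g ∧ (f : ℝ → ℝ) =ᵐ[vol01] g := ⟨g, g.continuous, h3⟩
  have h4 : pointEval f x = g x := by
    unfold pointEval
    rw [dif_pos hex]
    exact Measure.eqOn_Icc_of_ae_eq volume zero_ne_one (hex.choose_spec.2.symm.trans h3)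
      hex.choose_spec.1.continuousOn g.continuous.continuousOn hx
  rw [h4]
  exact (BoundedContinuousFunction.evalCLM ℝ x).hasSum hg

/-! ### Mean square norms of random series -/

section Series

variable {l : ℝ} {μ : Measure L2I}

/-- Pythagoras in `L²(μ; L²)`: the coefficients are uncorrelated, so the cross terms drop out even
though the `v k` need not be orthogonal. -/
theorem IsPeriodicRBFGaussian.eLpNorm_sum (hl : 0 < l) (hμ : IsPeriodicRBFGaussian l μ)
    (v : ℤ → L2I) (s : Finset ℤ) :
    MemLp (fun f : L2I => ∑ k ∈ s, (inner ℝ (hartleyLp k) f : ℝ) • v k) 2 μ ∧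
    eLpNorm (fun f : L2I => ∑ k ∈ s, (inner ℝ (hartleyLp k) f : ℝ) • v k) 2 μ =
      ENNReal.ofReal √(∑ k ∈ s, rbfEigenvalue l k * ‖v k‖ ^ 2) := by
  have hm : MemLp (fun f : L2I => ∑ k ∈ s, (inner ℝ (hartleyLp k) f : ℝ) • v k) 2 μ := by
    refine memLp_finsetSum _ fun k _ => ?_
    exact ((ContinuousLinearMap.id ℝ ℝ).smulRight (v k)).comp_memLp' (hμ.memLp_inner _)
  refine ⟨hm, ?_⟩
  rw [hm.eLpNorm_eq_integral_rpow_norm (by norm_num) (by norm_num), Real.sqrt_eq_rpow]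
  have e (f : L2I) : ‖∑ k ∈ s, (inner ℝ (hartleyLp k) f : ℝ) • v k‖ ^ 2 =
      ∑ j ∈ s, ∑ k ∈ s, inner ℝ (hartleyLp j) f * inner ℝ (hartleyLp k) f * inner ℝ (v j) (v k) := by
    rw [← real_inner_self_eq_norm_sq, sum_inner]
    refine Finset.sum_congr rfl fun j _ => ?_
    rw [inner_sum]
    refine Finset.sum_congr rfl fun k _ => ?_
    rw [real_inner_smul_left, real_inner_smul_right, mul_assoc]
  have hi (j k : ℤ) : Integrable (fun f : L2I =>
      inner ℝ (hartleyLp j) f * inner ℝ (hartleyLp k) f * inner ℝ (v j) (v k)) μ :=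
    ((hμ.memLp_inner _).integrable_mul (hμ.memLp_inner _)).mul_const _
  have key : ∫ f, ‖∑ k ∈ s, (inner ℝ (hartleyLp k) f : ℝ) • v k‖ ^ 2 ∂μ =
      ∑ k ∈ s, rbfEigenvalue l k * ‖v k‖ ^ 2 := by
    simp_rw [e]
    rw [integral_finsetSum _ fun j _ => integrable_finsetSum _ fun k _ => hi j k]
    refine Finset.sum_congr rfl fun j hj => ?_
    rw [integral_finsetSum _ fun k _ => hi j k]
    simp_rw [integral_mul_const, hμ.integral_inner_mul_inner hl]
    simp [hj]
  simp [key]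

/-- Fatou's lemma along the partial sums over `[-n, n]`; it yields measurability of `F` as well. -/
theorem IsPeriodicRBFGaussian.memLp_of_hasSum (hl : 0 < l) (hμ : IsPeriodicRBFGaussian l μ)
    {v : ℤ → L2I} {F : L2I → L2I}
    (hF : ∀ᵐ f ∂μ, HasSum (fun k => (inner ℝ (hartleyLp k) f : ℝ) • v k) (F f)) {B : ℝ}
    (hB : ∀ s : Finset ℤ, √(∑ k ∈ s, rbfEigenvalue l k * ‖v k‖ ^ 2) ≤ B) :
    MemLp F 2 μ ∧ eLpNorm F 2 μ ≤ ENNReal.ofReal B := by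
  let s (n : ℕ) : Finset ℤ := Finset.Icc (-n) n
  have hs : Filter.Tendsto s Filter.atTop Filter.atTop := by
    refine Filter.tendsto_atTop_finset_of_monotone (fun a b h => ?_) fun k => ⟨k.natAbs, ?_⟩
    · exact Finset.Icc_subset_Icc (by simpa using h) (by simpa using h)
    · simp only [s, Finset.mem_Icc]; omega
  have hlim : ∀ᵐ f ∂μ, Filter.Tendsto
      (fun n => ∑ k ∈ s n, (inner ℝ (hartleyLp k) f : ℝ) • v k) Filter.atTop (nhds (F f)) := by
    filter_upwards [hF] with f hf
    exact hf.comp hs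
  have hmeas (n : ℕ) := (hμ.eLpNorm_sum hl v (s n)).1.1
  have hle : eLpNorm F 2 μ ≤ ENNReal.ofReal B := by
    refine (Lp.eLpNorm_lim_le_liminf_eLpNorm hmeas F hlim).trans ?_
    refine Filter.liminf_le_of_le (by isBoundedDefault) fun b hb => ?_
    obtain ⟨n, hn⟩ := hb.exists
    refine hn.trans ?_
    rw [(hμ.eLpNorm_sum hl v (s n)).2]
    exact ENNReal.ofReal_le_ofReal (hB _)
  exact ⟨⟨aestronglyMeasurable_of_tendsto_ae _ hmeas hlim, hle.trans_lt ENNReal.ofReal_lt_top⟩, hle⟩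

end Series

/-! ### Piecewise linear functions as ReLU networks with one hidden layer -/

/-- The trunk net with one hidden layer that interpolates the values `y k i` at the knots `x i`,
`i ≤ N`, in its component `k + 1`, and whose component `0` vanishes. -/
noncomputable def interpolationNet {p : ℕ} (N : ℕ) (x : ℕ → ℝ) (y : Fin p → ℕ → ℝ) :
    ReLUNet 1 (p + 1) :=
  .hidden (fun (_ : Fin (N + 1)) _ => 1) (fun i => -x i)
    (.output
      (Fin.cases 0 fun k j => ∑ i ∈ Finset.range N, (y k (i + 1) - y k i) / (x (i + 1) - x i) *
        ((if (j : ℕ) = i then 1 else 0) - if (j : ℕ) = i + 1 then 1 else 0))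
      (Fin.cases 0 fun k => y k 0))

theorem hiddenSize_interpolationNet {p : ℕ} (N : ℕ) (x : ℕ → ℝ) (y : Fin p → ℕ → ℝ) :
    (interpolationNet N x y).hiddenSize = N + 1 := rfl

theorem interpolationNet_eval_zero {p : ℕ} (N : ℕ) (x : ℕ → ℝ) (y : Fin p → ℕ → ℝ) (t : ℝ) :
    (interpolationNet N x y).eval (fun _ => t) 0 = 0 := by
  simp [interpolationNet, ReLUNet.eval, Matrix.mulVec, dotProduct]

theorem interpolationNet_eval_succ {p : ℕ} (N : ℕ) (x : ℕ → ℝ) (y : Fin p → ℕ → ℝ) (t : ℝ)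
    (k : Fin p) :
    (interpolationNet N x y).eval (fun _ => t) k.succ =
      y k 0 + ∑ i ∈ Finset.range N, (y k (i + 1) - y k i) / (x (i + 1) - x i) *
        (max 0 (t - x i) - max 0 (t - x (i + 1))) := by
  have h (i : ℕ) (hi : i < N + 1) :
      ∑ j : Fin (N + 1), (if (j : ℕ) = i then (1 : ℝ) else 0) * max 0 (t - x j) =
        max 0 (t - x i) := by
    rw [Finset.sum_eq_single ⟨i, hi⟩]
    · simp
    · intro j _ hj
      rw [if_neg (fun h => hj (Fin.ext h)), zero_mul]
    · simp
  simp only [interpolationNet, ReLUNet.eval, Matrix.mulVec, dotProduct, Pi.add_apply,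
    Finset.univ_unique, Finset.sum_singleton, one_mul, Fin.cases_succ]
  rw [add_comm]
  congr 1
  simp_rw [Finset.sum_mul]
  rw [Finset.sum_comm]
  refine Finset.sum_congr rfl fun i hi => ?_
  have hi' := Finset.mem_range.1 hi
  rw [← h i (by omega), ← h (i + 1) (by omega), ← Finset.sum_sub_distrib, Finset.mul_sum]
  refine Finset.sum_congr rfl fun j _ => ?_
  rw [← sub_eq_add_neg]
  ring

/-- Ramps of cells to the left of `t` are saturated and telescope to `y k j - y k 0`; those to the
right are still zero. -/
theorem interpolationNet_eval_of_mem {p : ℕ} {N : ℕ} {x : ℕ → ℝ} (hx : StrictMono x)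
    (y : Fin p → ℕ → ℝ) {j : ℕ} (hj : j < N) {t : ℝ} (ht : t ∈ Icc (x j) (x (j + 1))) (k : Fin p) :
    (interpolationNet N x y).eval (fun _ => t) k.succ =
      y k j + (y k (j + 1) - y k j) / (x (j + 1) - x j) * (t - x j) := by
  rw [interpolationNet_eval_succ]
  have hpos (i : ℕ) : x (i + 1) - x i ≠ 0 := (sub_pos.2 (hx (Nat.lt_succ_self i))).ne'
  have h1 : ∑ i ∈ Finset.range j, (y k (i + 1) - y k i) / (x (i + 1) - x i) *
      (max 0 (t - x i) - max 0 (t - x (i + 1))) = y k j - y k 0 := by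
    rw [← Finset.sum_range_sub]
    refine Finset.sum_congr rfl fun i hi => ?_
    have hi' := Finset.mem_range.1 hi
    have a1 : x i ≤ t := (hx.monotone hi'.le).trans ht.1
    have a2 : x (i + 1) ≤ t := (hx.monotone hi').trans ht.1
    rw [max_eq_right (by linarith), max_eq_right (by linarith)]
    have := hpos i
    field_simp
    ring
  have h2 : ∑ i ∈ Finset.Ico (j + 1) N, (y k (i + 1) - y k i) / (x (i + 1) - x i) *
      (max 0 (t - x i) - max 0 (t - x (i + 1))) = 0 := by
    refine Finset.sum_eq_zero fun i hi => ?_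
    have hi' := (Finset.mem_Ico.1 hi).1
    have a1 : t ≤ x i := ht.2.trans (hx.monotone hi')
    have a2 : t ≤ x (i + 1) := a1.trans (hx.monotone (Nat.le_succ i))
    rw [max_eq_left (by linarith), max_eq_left (by linarith)]
    simp
  rw [← Finset.sum_range_add_sum_Ico _ (show j + 1 ≤ N from hj), Finset.sum_range_succ, h1, h2,
    max_eq_right (sub_nonneg.2 ht.1), max_eq_left (sub_nonpos.2 ht.2)]
  ring

/-! ### The branch net and the error series -/

/-- The affine branch net that maps samples at the grid `j / m` to the discrete Hartley
coefficients with index `k - K`, `k < p`, of frequency at most `M`. -/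
noncomputable def hartleyBranch (m p K M : ℕ) : ReLUNet m p :=
  .output (fun k i => if |((k : ℕ) : ℤ) - K| ≤ M then
    (m : ℝ)⁻¹ * hartley ((k : ℕ) - K) (((i : ℕ) + 1 : ℝ) / m) else 0) 0

theorem size_hartleyBranch (m p K M : ℕ) : (hartleyBranch m p K M).size = m + p := rfl

/-- Aliasing: each sample is expanded in the Hartley series, and summation over the grid keeps
exactly the frequencies congruent to `κ - K` modulo `m`. -/
theorem hasSum_hartleyBranch {m p K M : ℕ} (hm : m ≠ 0) {f : L2I}
    (hf : Summable fun k => |inner ℝ (hartleyLp k) f|) (κ : Fin p) :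
    HasSum (fun k : ℤ => (inner ℝ (hartleyLp k) f : ℝ) *
      if |((κ : ℕ) : ℤ) - K| ≤ M ∧ (m : ℤ) ∣ ((κ : ℕ) : ℤ) - K - k then 1 else 0)
      ((hartleyBranch m p K M).eval (encoder m f) κ) := by
  have hm' : (m : ℝ) ≠ 0 := by exact_mod_cast hm
  have e : (hartleyBranch m p K M).eval (encoder m f) κ = ∑ i : Fin m,
      (if |((κ : ℕ) : ℤ) - K| ≤ M then
        (m : ℝ)⁻¹ * hartley ((κ : ℕ) - K) (((i : ℕ) + 1 : ℝ) / m) else 0) *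
      pointEval f (((i : ℕ) + 1 : ℝ) / m) := by
    simp [hartleyBranch, ReLUNet.eval, Matrix.mulVec, dotProduct, encoder]
  rw [e]
  have hx (i : Fin m) : (((i : ℕ) + 1 : ℝ) / m) ∈ Icc (0 : ℝ) 1 := by
    refine ⟨by positivity, ?_⟩
    rw [div_le_one (by positivity)]
    exact_mod_cast i.2
  have hs := hasSum_sum (s := Finset.univ) fun (i : Fin m) _ =>
    (hasSum_pointEval hf (hx i)).mul_left (if |((κ : ℕ) : ℤ) - K| ≤ M then
        (m : ℝ)⁻¹ * hartley ((κ : ℕ) - K) (((i : ℕ) + 1 : ℝ) / m) else 0)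
  convert! hs using 2 with k
  by_cases hκ : |((κ : ℕ) : ℤ) - K| ≤ M
  · simp only [hκ, if_true, true_and]
    have := sum_grid_hartley_mul_hartley ((κ : ℕ) - K) k hm
    calc (inner ℝ (hartleyLp k) f : ℝ) * (if (m : ℤ) ∣ ((κ : ℕ) : ℤ) - K - k then 1 else 0)
        = (m : ℝ)⁻¹ * (inner ℝ (hartleyLp k) f : ℝ) *
          (if (m : ℤ) ∣ ((κ : ℕ) : ℤ) - K - k then (m : ℝ) else 0) := by
          split_ifs
          · field_simp
          · simp
      _ = _ := by
          rw [← this, Finset.mul_sum]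
          exact Finset.sum_congr rfl fun i _ => by ring
  · simp [hκ]

/-- The component `k + 1` of a trunk net as an element of `L²([0,1])`. -/
noncomputable def trunkLp {p : ℕ} (τ : ReLUNet 1 (p + 1)) (k : Fin p) : L2I :=
  (memLp_of_continuous (g := fun x => τ.eval (fun _ => x) k.succ)
    ((continuous_apply _).comp (τ.continuous_eval.comp (continuous_pi fun _ => continuous_id)))).toLp _

theorem deepONet_eq_sum {m p : ℕ} (β : ReLUNet m p) {τ : ReLUNet 1 (p + 1)}
    (hτ : ∀ x, τ.eval (fun _ => x) 0 = 0) (f : L2I) :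
    deepONet β τ f = ∑ k, β.eval (encoder m f) k • trunkLp τ k := by
  refine Lp.ext ?_
  have h1 (k : Fin p) : (trunkLp τ k : ℝ → ℝ) =ᵐ[vol01] fun x => τ.eval (fun _ => x) k.succ :=
    MemLp.coeFn_toLp _
  have h2 := Lp.coeFn_fun_finsetSum Finset.univ fun k => β.eval (encoder m f) k • trunkLp τ k
  have h3 (k : Fin p) := Lp.coeFn_smul (β.eval (encoder m f) k) (trunkLp τ k)
  filter_upwards [h2, ae_all_iff.2 h1, ae_all_iff.2 h3,
    (memLp_reconstruct τ (β.eval (encoder m f))).coeFn_toLp] with x a2 a1 a3 a4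
  unfold deepONet
  rw [a4, a2, reconstruct, hτ, zero_add]
  refine Finset.sum_congr rfl fun k _ => ?_
  rw [a3 k, Pi.smul_apply, a1 k, smul_eq_mul]

/-- The output of the operator network for the input `hartley k`. -/
noncomputable def aliasedTrunk {p : ℕ} (m K M : ℕ) (τ : ReLUNet 1 (p + 1)) (k : ℤ) : L2I :=
  ∑ κ : Fin p, (if |((κ : ℕ) : ℤ) - K| ≤ M ∧ (m : ℤ) ∣ ((κ : ℕ) : ℤ) - K - k then (1 : ℝ) else 0) •
    trunkLp τ κ

/-- The frequencies of modulus at most `M` are pairwise incongruent modulo `2M + 1`, so a frequency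
has at most one alias. -/
theorem aliasedTrunk_eq {p m K M : ℕ} (hm : m = 2 * M + 1) (τ : ReLUNet 1 (p + 1)) {k : ℤ}
    {κ : Fin p} (hκ : |((κ : ℕ) : ℤ) - K| ≤ M ∧ (m : ℤ) ∣ ((κ : ℕ) : ℤ) - K - k) :
    aliasedTrunk m K M τ k = trunkLp τ κ := by
  unfold aliasedTrunk
  rw [Finset.sum_eq_single κ, if_pos hκ, one_smul]
  · intro j _ hj
    rw [if_neg, zero_smul]
    rintro ⟨h1, h2⟩
    refine hj (Fin.ext ?_)
    have h3 := dvd_sub h2 hκ.2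
    have h4 : ((j : ℕ) : ℤ) - K - k - (((κ : ℕ) : ℤ) - K - k) = 0 := by
      refine Int.eq_zero_of_abs_lt_dvd h3 ?_
      have := hκ.1
      rw [abs_le] at *
      rw [abs_lt]
      subst hm
      push_cast
      constructor <;> linarith
    omega
  · simp

/-- Up to `min K M` a frequency is its own alias and only the trunk error remains. Any other
frequency is mapped to a retained alias or to zero, and the triangle inequality with `‖G h‖ ≤ Λ`
suffices. -/
theorem norm_sub_aliasedTrunk_le {p m K M : ℕ} (hm : m = 2 * M + 1) (hp : p = 2 * K + 1)
    {τ : ReLUNet 1 (p + 1)} {G : L2I →L[ℝ] L2I} {Λ δ : ℝ} (hG : ‖G‖ ≤ Λ)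
    (hτ : ∀ κ : Fin p, ‖G (hartleyLp ((κ : ℕ) - K)) - trunkLp τ κ‖ ≤ δ) (k : ℤ) :
    ‖G (hartleyLp k) - aliasedTrunk m K M τ k‖ ≤ 2 * Λ + δ ∧
    (|k| ≤ (min K M : ℕ) → ‖G (hartleyLp k) - aliasedTrunk m K M τ k‖ ≤ δ) := by
  have hΛ (k : ℤ) : ‖G (hartleyLp k)‖ ≤ Λ := by
    simpa [norm_hartleyLp] using G.le_of_opNorm_le hG (hartleyLp k)
  have hδ : 0 ≤ δ := (norm_nonneg _).trans (hτ ⟨0, by omega⟩)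
  refine ⟨?_, fun hk => ?_⟩
  · by_cases h : ∃ κ : Fin p, |((κ : ℕ) : ℤ) - K| ≤ M ∧ (m : ℤ) ∣ ((κ : ℕ) : ℤ) - K - k
    · obtain ⟨κ, hκ⟩ := h
      rw [aliasedTrunk_eq hm τ hκ]
      have e : G (hartleyLp k) - trunkLp τ κ = G (hartleyLp k) - G (hartleyLp ((κ : ℕ) - K)) +
        (G (hartleyLp ((κ : ℕ) - K)) - trunkLp τ κ) := by abel
      rw [e]
      refine (norm_add_le _ _).trans (add_le_add ((norm_sub_le _ _).trans ?_) (hτ κ))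
      linarith [hΛ k, hΛ ((κ : ℕ) - K)]
    · have : aliasedTrunk m K M τ k = 0 := by
        refine Finset.sum_eq_zero fun κ _ => ?_
        rw [if_neg (fun h' => h ⟨κ, h'⟩), zero_smul]
      rw [this, sub_zero]
      linarith [hΛ k, (norm_nonneg _).trans (hΛ k)]
  · rw [abs_le] at hk
    push_cast at hk
    have h1 : (min (K : ℤ) M) ≤ K := min_le_left _ _
    have h2 : (min (K : ℤ) M) ≤ M := min_le_right _ _
    let κ : Fin p := ⟨(k + K).toNat, by omega⟩
    have e : ((κ : ℕ) : ℤ) - K = k := by simp only [κ]; omega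
    rw [aliasedTrunk_eq hm τ (κ := κ) ⟨by rw [e, abs_le]; constructor <;> omega, by simp [e]⟩]
    have := hτ κ
    rwa [e] at this

/-- The mean square error of the operator network with branch net `hartleyBranch`, in terms of the
approximation of the images of the Hartley functions by the trunk net. -/
theorem IsPeriodicRBFGaussian.eLpNorm_sub_deepONet_le {l l₀ : ℝ} {μ : Measure L2I} (hl : 0 < l)
    (hl₀ : l ≤ l₀) (hμ : IsPeriodicRBFGaussian l μ) {p m K M : ℕ} (hm : m = 2 * M + 1)
    (hp : p = 2 * K + 1) {τ : ReLUNet 1 (p + 1)} (hτ₀ : ∀ x, τ.eval (fun _ => x) 0 = 0)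
    {G : L2I →L[ℝ] L2I} {Λ δ : ℝ} (hG : ‖G‖ ≤ Λ)
    (hτ : ∀ κ : Fin p, ‖G (hartleyLp ((κ : ℕ) - K)) - trunkLp τ κ‖ ≤ δ) :
    MemLp (fun f => G f - deepONet (hartleyBranch m p K M) τ f) 2 μ ∧
    eLpNorm (fun f => G f - deepONet (hartleyBranch m p K M) τ f) 2 μ ≤
      ENNReal.ofReal (√(traceBound l₀) * (δ + 2 * (2 * Λ + δ) *
        (Real.exp (-(Real.pi ^ 2 * l ^ 2 * (K : ℝ) ^ 2)) +
          Real.exp (-(Real.pi ^ 2 * l ^ 2 * (M : ℝ) ^ 2))))) := by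
  have hδ : 0 ≤ δ := (norm_nonneg _).trans (hτ ⟨0, by omega⟩)
  have hΛ : 0 ≤ Λ := (norm_nonneg _).trans hG
  have hv := norm_sub_aliasedTrunk_le (M := M) hm hp hG hτ
  refine hμ.memLp_of_hasSum hl (v := fun k => G (hartleyLp k) - aliasedTrunk m K M τ k) ?_ ?_
  · filter_upwards [hμ.ae_summable_abs_inner hl] with f hf
    simp_rw [smul_sub]
    have h1 := G.hasSum (hasSum_inner_hartleyLp f)
    simp only [map_smul] at h1
    refine h1.sub ?_
    rw [deepONet_eq_sum _ hτ₀]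
    have h2 := hasSum_sum (s := Finset.univ) fun (κ : Fin p) _ =>
      (hasSum_hartleyBranch (K := K) (M := M) (by omega : m ≠ 0) hf κ).smul_const (trunkLp τ κ)
    convert! h2 using 2 with k
    rw [aliasedTrunk, Finset.smul_sum]
    simp_rw [smul_smul]
  · intro s
    set EK := Real.exp (-(Real.pi ^ 2 * l ^ 2 * (K : ℝ) ^ 2))
    set EM := Real.exp (-(Real.pi ^ 2 * l ^ 2 * (M : ℝ) ^ 2))
    have hEK : 0 < EK := Real.exp_pos _
    have hEM : 0 < EM := Real.exp_pos _
    -- The eigenvalues are variances, so their tail factor is the square of the claimed rate.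
    have hE : Real.exp (-(2 * Real.pi ^ 2 * l ^ 2 * ((min K M : ℕ) : ℝ) ^ 2)) ≤ (EK + EM) ^ 2 := by
      rcases min_choice K M with h | h
      · have : Real.exp (-(2 * Real.pi ^ 2 * l ^ 2 * ((min K M : ℕ) : ℝ) ^ 2)) = EK ^ 2 := by
          rw [h, ← Real.exp_nat_mul]; congr 1; push_cast; ring
        rw [this]; gcongr; linarith
      · have : Real.exp (-(2 * Real.pi ^ 2 * l ^ 2 * ((min K M : ℕ) : ℝ) ^ 2)) = EM ^ 2 := by
          rw [h, ← Real.exp_nat_mul]; congr 1; push_cast; ring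
        rw [this]; gcongr; linarith
    have h := sum_rbfEigenvalue_mul_sq_le hl hl₀
      (b := fun k => ‖G (hartleyLp k) - aliasedTrunk m K M τ k‖) (fun k => norm_nonneg _)
      (fun k => (hv k).2) (fun k => (hv k).1) s
    have hT := traceBound_nonneg l₀
    refine Real.sqrt_le_iff.2 ⟨by positivity, h.trans ?_⟩
    rw [mul_pow, Real.sq_sqrt hT, mul_comm]
    refine mul_le_mul_of_nonneg_left ?_ hT
    have h5 : 2 * (2 * Λ + δ) ^ 2 * Real.exp (-(2 * Real.pi ^ 2 * l ^ 2 * ((min K M : ℕ) : ℝ) ^ 2))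
        ≤ 2 * (2 * Λ + δ) ^ 2 * (EK + EM) ^ 2 := by gcongr
    have h6 : 0 ≤ (2 * Λ + δ) * (EK + EM) := by positivity
    -- With `y = (2Λ + δ)(EK + EM)` this is `δ² + 2y² ≤ (δ + 2y)²`.
    nlinarith [mul_nonneg hδ h6]

/-! ### The space `H₀¹(0,1)` -/

/-- The graph of the derivative on the test functions. -/
def testGraph : Submodule ℝ (L2I × L2I) where
  carrier := {w | ∃ φ : ℝ → ℝ, ContDiff ℝ ∞ φ ∧ HasCompactSupport φ ∧ tsupport φ ⊆ Ioo 0 1 ∧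
    (w.1 : ℝ → ℝ) =ᵐ[vol01] φ ∧ (w.2 : ℝ → ℝ) =ᵐ[vol01] deriv φ}
  zero_mem' := by
    refine ⟨0, contDiff_const, HasCompactSupport.zero, by simp, Lp.coeFn_zero _ _ _, ?_⟩
    have : deriv (0 : ℝ → ℝ) = 0 := by funext x; simp
    rw [this]
    exact Lp.coeFn_zero _ _ _
  add_mem' := by
    rintro w z ⟨φ, h1, h2, h3, h4, h5⟩ ⟨ψ, k1, k2, k3, k4, k5⟩
    refine ⟨φ + ψ, h1.add k1, h2.add k2, ?_, ?_, ?_⟩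
    · exact (tsupport_add φ ψ).trans (union_subset h3 k3)
    · exact (Lp.coeFn_add _ _).trans (h4.add k4)
    · have : deriv (φ + ψ) = deriv φ + deriv ψ := by
        funext x
        exact deriv_add (h1.differentiable (by simp) x) (k1.differentiable (by simp) x)
      rw [this]
      exact (Lp.coeFn_add _ _).trans (h5.add k5)
  smul_mem' := by
    rintro r w ⟨φ, h1, h2, h3, h4, h5⟩
    refine ⟨r • φ, contDiff_const.smul h1, h2.smul_left (f := fun _ => r), ?_, ?_, ?_⟩
    · exact (tsupport_smul_subset_right (fun _ => r) φ).trans h3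
    · exact (Lp.coeFn_smul _ _).trans (h4.const_smul r)
    · have : deriv (r • φ) = r • deriv φ := by
        funext x
        exact deriv_const_smul _ (h1.differentiable (by simp) x)
      rw [this]
      exact (Lp.coeFn_smul _ _).trans (h5.const_smul r)

theorem H01_eq : H01 = (testGraph.topologicalClosure : Set (L2I × L2I)) := rfl

theorem H01_add {u du v dv : L2I} (h : (u, du) ∈ H01) (h' : (v, dv) ∈ H01) :
    (u + v, du + dv) ∈ H01 := by
  rw [H01_eq] at *
  exact testGraph.topologicalClosure.add_mem h h'

theorem H01_smul (r : ℝ) {u du : L2I} (h : (u, du) ∈ H01) : (r • u, r • du) ∈ H01 := by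
  rw [H01_eq] at *
  exact testGraph.topologicalClosure.smul_mem r h

theorem integral_abs_le_norm (f : L2I) : ∫ x, |f x| ∂vol01 ≤ ‖f‖ := by
  have h := eLpNorm_le_eLpNorm_of_exponent_le (μ := vol01) (p := 1) (q := 2) (by norm_num)
    (Lp.aestronglyMeasurable f)
  rw [Lp.norm_def]
  have h2 : ∫ x, |f x| ∂vol01 = (eLpNorm f 1 vol01).toReal := by
    rw [eLpNorm_one_eq_lintegral_enorm, ← integral_norm_eq_lintegral_enorm
      (Lp.aestronglyMeasurable f)]
    rfl
  rw [h2]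
  exact ENNReal.toReal_mono (Lp.eLpNorm_ne_top f) h

theorem integrable_coeFn (f : L2I) : Integrable f vol01 := (Lp.memLp f).integrable (by norm_num)

theorem norm_le_of_ae_abs_le {f : L2I} {C : ℝ} (hC : 0 ≤ C) (h : ∀ᵐ x ∂vol01, |f x| ≤ C) :
    ‖f‖ ≤ C := by
  have := Lp.norm_le_of_ae_bound (f := f) (μ := vol01) hC h
  simpa [measureUnivNNReal] using this

/-- The primitive of `f ∈ L²([0,1])` that vanishes at `0`, extended by constants. -/
noncomputable def primitive (f : L2I) (x : ℝ) : ℝ := ∫ t in (0 : ℝ)..x, (Icc (0 : ℝ) 1).indicator f t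

theorem integrable_indicator_coeFn (f : L2I) : Integrable ((Icc (0 : ℝ) 1).indicator f) :=
  (integrable_indicator_iff measurableSet_Icc).2 (integrable_coeFn f)

theorem continuous_primitive_coeFn (f : L2I) : Continuous (primitive f) :=
  intervalIntegral.continuous_primitive
    (fun _ _ => (integrable_indicator_coeFn f).intervalIntegrable) 0

/-- The primitive is 1-Lipschitz from `L²` to the sup norm, so identities that involve it are closed
conditions and pass from test functions to `H01`. -/
theorem abs_primitive_sub_le (f g : L2I) (x : ℝ) : |primitive f x - primitive g x| ≤ ‖f - g‖ := by
  unfold primitive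
  rw [← intervalIntegral.integral_sub (integrable_indicator_coeFn f).intervalIntegrable
    (integrable_indicator_coeFn g).intervalIntegrable]
  have hi := (integrable_indicator_coeFn f).sub (integrable_indicator_coeFn g)
  have h1 := intervalIntegral.norm_integral_le_integral_norm_uIoc (μ := volume) (a := 0) (b := x)
    (f := fun t => (Icc (0 : ℝ) 1).indicator f t - (Icc (0 : ℝ) 1).indicator g t)
  refine h1.trans ((setIntegral_le_integral hi.norm
    (Filter.Eventually.of_forall fun _ => norm_nonneg _)).trans ?_)
  refine le_trans (le_of_eq ?_) (integral_abs_le_norm (f - g))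
  rw [← integral_indicator measurableSet_Icc]
  have h2 : ∀ᵐ x ∂volume, x ∈ Icc (0 : ℝ) 1 → (f - g : L2I) x = f x - g x :=
    (ae_restrict_iff' measurableSet_Icc).1 (Lp.coeFn_sub f g)
  refine integral_congr_ae ?_
  filter_upwards [h2] with t ht
  by_cases hm : t ∈ Icc (0 : ℝ) 1
  · rw [indicator_of_mem hm, ht hm, Pi.sub_apply, indicator_of_mem hm, indicator_of_mem hm]
    rfl
  · simp [hm]

/-- The primitive as an element of `L²([0,1])`. -/
noncomputable def primitiveLp (f : L2I) : L2I :=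
  (memLp_of_continuous (continuous_primitive_coeFn f)).toLp _

theorem continuous_primitiveLp : Continuous primitiveLp := by
  refine (LipschitzWith.of_dist_le_mul (K := 1) fun f g => ?_).continuous
  rw [dist_eq_norm, dist_eq_norm, NNReal.coe_one, one_mul]
  refine norm_le_of_ae_abs_le (norm_nonneg _) ?_
  filter_upwards [Lp.coeFn_sub (primitiveLp f) (primitiveLp g),
    MemLp.coeFn_toLp (memLp_of_continuous (continuous_primitive_coeFn f)),
    MemLp.coeFn_toLp (memLp_of_continuous (continuous_primitive_coeFn g))] with x h1 h2 h3
  rw [h1, Pi.sub_apply]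
  unfold primitiveLp
  rw [h2, h3]
  exact abs_primitive_sub_le f g x

theorem primitive_eq_of_ae_eq {f : L2I} {g : ℝ → ℝ} (h : (f : ℝ → ℝ) =ᵐ[vol01] g) {x : ℝ}
    (hx : x ∈ Icc (0 : ℝ) 1) : primitive f x = ∫ t in (0 : ℝ)..x, g t := by
  unfold primitive
  refine intervalIntegral.integral_congr_ae ?_
  filter_upwards [(ae_restrict_iff' measurableSet_Icc).1 h] with t ht h2
  rw [uIoc_of_le hx.1] at h2
  have hm : t ∈ Icc (0 : ℝ) 1 := ⟨h2.1.le, h2.2.trans hx.2⟩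
  rw [indicator_of_mem hm, ht hm]

theorem eq_zero_of_tsupport_subset {φ : ℝ → ℝ} (h : tsupport φ ⊆ Ioo 0 1) {x : ℝ}
    (hx : x ∉ Ioo (0 : ℝ) 1) : φ x = 0 :=
  image_eq_zero_of_notMem_tsupport fun h' => hx (h h')

theorem H01_subset_of_isClosed {P : L2I × L2I → Prop} (hP : IsClosed {w | P w})
    (h : ∀ φ : ℝ → ℝ, ContDiff ℝ ∞ φ → tsupport φ ⊆ Ioo 0 1 → ∀ u du : L2I,
      (u : ℝ → ℝ) =ᵐ[vol01] φ → (du : ℝ → ℝ) =ᵐ[vol01] deriv φ → P (u, du)) {w : L2I × L2I}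
    (hw : w ∈ H01) : P w := by
  refine closure_minimal (t := {w | P w}) ?_ hP hw
  rintro w ⟨φ, h1, _, h3, h4, h5⟩
  exact h φ h1 h3 w.1 w.2 h4 h5

theorem H01_eq_primitive {u du : L2I} (h : (u, du) ∈ H01) :
    (u : ℝ → ℝ) =ᵐ[vol01] primitive du ∧ primitive du 1 = 0 := by
  have h1 : u = primitiveLp du := by
    refine H01_subset_of_isClosed (P := fun w => w.1 = primitiveLp w.2) ?_ ?_ h
    · exact isClosed_eq continuous_fst (continuous_primitiveLp.comp continuous_snd)
    · intro φ hφ hs u du hu hdu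
      refine Lp.ext ?_
      have := MemLp.coeFn_toLp (memLp_of_continuous (continuous_primitive_coeFn du))
      filter_upwards [hu, this, ae_restrict_mem measurableSet_Icc] with x e1 e2 hx
      unfold primitiveLp
      rw [e1, e2, primitive_eq_of_ae_eq hdu hx, intervalIntegral.integral_deriv_eq_sub'
        φ rfl (fun y _ => hφ.differentiable (by simp) y) (hφ.continuous_deriv (by simp)).continuousOn,
        eq_zero_of_tsupport_subset hs (by simp : (0 : ℝ) ∉ Ioo (0 : ℝ) 1), sub_zero]
  refine ⟨?_, ?_⟩
  · have := MemLp.coeFn_toLp (memLp_of_continuous (continuous_primitive_coeFn du))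
    rw [h1]
    exact this
  · refine H01_subset_of_isClosed (P := fun w => primitive w.2 1 = 0) ?_ ?_ h
    · refine isClosed_eq (Continuous.comp (g := fun f => primitive f 1) ?_ continuous_snd)
        continuous_const
      refine (LipschitzWith.of_dist_le_mul (K := 1) fun f g => ?_).continuous
      rw [dist_eq_norm, dist_eq_norm, NNReal.coe_one, one_mul]
      exact abs_primitive_sub_le f g 1
    · intro φ hφ hs u du hu hdu
      simp only
      rw [primitive_eq_of_ae_eq hdu (by simp), intervalIntegral.integral_deriv_eq_sub'
        φ rfl (fun y _ => hφ.differentiable (by simp) y) (hφ.continuous_deriv (by simp)).continuousOn,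
        eq_zero_of_tsupport_subset hs (by simp : (0 : ℝ) ∉ Ioo (0 : ℝ) 1),
        eq_zero_of_tsupport_subset hs (by simp : (1 : ℝ) ∉ Ioo (0 : ℝ) 1), sub_zero]

theorem continuous_integral_mul {g : ℝ → ℝ} (hg : Continuous g) :
    Continuous fun f : L2I => ∫ x, g x * f x ∂vol01 := by
  have h (f : L2I) : ∫ x, g x * f x ∂vol01 = inner ℝ ((memLp_of_continuous hg).toLp g) f := by
    rw [inner_L2I]
    refine integral_congr_ae ?_
    filter_upwards [MemLp.coeFn_toLp (memLp_of_continuous hg)] with x hx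
    rw [hx]
  simp_rw [h]
  exact continuous_const.inner continuous_id

/-- No boundary condition on `ψ` is needed: the boundary terms vanish for test functions, and both
sides are continuous on the graph. -/
theorem H01_integral_by_parts {u du : L2I} (h : (u, du) ∈ H01) {ψ ψ' : ℝ → ℝ}
    (hψ : ∀ x, HasDerivAt ψ (ψ' x) x) (hψ' : Continuous ψ') :
    ∫ x, ψ x * du x ∂vol01 = -∫ x, ψ' x * u x ∂vol01 := by
  have hc : Continuous ψ := continuous_iff_continuousAt.2 fun x => (hψ x).continuousAt
  refine H01_subset_of_isClosed
    (P := fun w => ∫ x, ψ x * w.2 x ∂vol01 = -∫ x, ψ' x * w.1 x ∂vol01) ?_ ?_ h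
  · exact isClosed_eq ((continuous_integral_mul hc).comp continuous_snd)
      ((continuous_integral_mul hψ').comp continuous_fst).neg
  · intro φ hφ hs u du hu hdu
    simp only
    have e1 : ∫ x, ψ x * du x ∂vol01 = ∫ x in (0 : ℝ)..1, ψ x * deriv φ x := by
      rw [← integral_vol01]
      refine integral_congr_ae ?_
      filter_upwards [hdu] with x hx
      rw [hx]
    have e2 : ∫ x, ψ' x * u x ∂vol01 = ∫ x in (0 : ℝ)..1, ψ' x * φ x := by
      rw [← integral_vol01]
      refine integral_congr_ae ?_
      filter_upwards [hu] with x hx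
      rw [hx]
    rw [e1, e2, intervalIntegral.integral_mul_deriv_eq_deriv_mul (u := ψ) (u' := ψ') (v := φ)
      (fun x _ => hψ x) (fun x _ => (hφ.differentiable (by simp) x).hasDerivAt)
      (hψ'.intervalIntegrable _ _) ((hφ.continuous_deriv (by simp)).intervalIntegrable _ _),
      eq_zero_of_tsupport_subset hs (by simp : (0 : ℝ) ∉ Ioo (0 : ℝ) 1),
      eq_zero_of_tsupport_subset hs (by simp : (1 : ℝ) ∉ Ioo (0 : ℝ) 1)]
    simp

theorem mem_H01_of_test {φ : ℝ → ℝ} (hφ : ContDiff ℝ ∞ φ) (hs : tsupport φ ⊆ Ioo 0 1) :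
    ((memLp_of_continuous hφ.continuous).toLp φ,
      (memLp_of_continuous (hφ.continuous_deriv (by simp))).toLp (deriv φ)) ∈ H01 :=
  subset_closure ⟨φ, hφ, HasCompactSupport.of_support_subset_isCompact isCompact_Icc
    ((subset_tsupport φ).trans (hs.trans Ioo_subset_Icc_self)), hs, MemLp.coeFn_toLp (memLp_of_continuous hφ.continuous),
    MemLp.coeFn_toLp (memLp_of_continuous (hφ.continuous_deriv (by simp)))⟩

/-! ### The lemma of du Bois-Reymond -/

/-- The zero mean makes the primitive vanish again to the right of the support of `χ`. -/
theorem exists_test_primitive {χ : ℝ → ℝ} (hχ : ContDiff ℝ ∞ χ) (hs : tsupport χ ⊆ Ioo 0 1)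
    (h0 : ∫ x, χ x ∂vol01 = 0) :
    ∃ φ : ℝ → ℝ, ContDiff ℝ ∞ φ ∧ tsupport φ ⊆ Ioo 0 1 ∧ deriv φ = χ := by
  have hd (x : ℝ) : HasDerivAt (fun x => ∫ t in (0 : ℝ)..x, χ t) (χ x) x :=
    intervalIntegral.integral_hasDerivAt_right (hχ.continuous.intervalIntegrable _ _)
      (hχ.continuous.stronglyMeasurableAtFilter _ _) hχ.continuous.continuousAt
  have hde : deriv (fun x => ∫ t in (0 : ℝ)..x, χ t) = χ := funext fun x => (hd x).deriv
  refine ⟨fun x => ∫ t in (0 : ℝ)..x, χ t, ?_, ?_, hde⟩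
  · rw [contDiff_infty_iff_deriv]
    exact ⟨fun x => (hd x).differentiableAt, by rwa [hde]⟩
  · have hK : IsCompact (tsupport χ) :=
      isCompact_Icc.of_isClosed_subset (isClosed_tsupport χ) (hs.trans Ioo_subset_Icc_self)
    obtain ⟨p, q, hp, hq, hpq⟩ : ∃ p q : ℝ, 0 < p ∧ q < 1 ∧ tsupport χ ⊆ Icc p q := by
      rcases (tsupport χ).eq_empty_or_nonempty with h | h
      · exact ⟨1 / 2, 1 / 2, by norm_num, by norm_num, by simp [h]⟩
      · obtain ⟨p, hp, hp'⟩ := hK.exists_isLeast h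
        obtain ⟨q, hq, hq'⟩ := hK.exists_isGreatest h
        exact ⟨p, q, (hs hp).1, (hs hq).2, fun x hx => ⟨hp' hx, hq' hx⟩⟩
    have hz {t : ℝ} (ht : t ∉ Icc p q) : χ t = 0 :=
      image_eq_zero_of_notMem_tsupport fun h' => ht (hpq h')
    have : (tsupport fun x => ∫ t in (0 : ℝ)..x, χ t) ⊆ Icc p q := by
      refine closure_minimal (fun x hx => ?_) isClosed_Icc
      by_contra hx'
      refine hx ?_
      simp only
      rw [mem_Icc, not_and_or, not_le, not_le] at hx'
      rcases hx' with h | h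
      · have : ∫ t in (0 : ℝ)..x, χ t = ∫ t in (0 : ℝ)..x, (0 : ℝ) := by
          refine intervalIntegral.integral_congr fun t ht => hz fun h' => ?_
          have := (mem_uIcc.1 ht)
          rcases this with h2 | h2 <;> linarith [h'.1, h2.1, h2.2]
        simpa using this
      · rw [integral_vol01] at h0
        have h2 : ∫ t in (1 : ℝ)..x, χ t = ∫ t in (1 : ℝ)..x, (0 : ℝ) := by
          refine intervalIntegral.integral_congr fun t ht => hz fun h' => ?_
          have := (mem_uIcc.1 ht)
          rcases this with h2 | h2 <;> linarith [h'.2, h2.1, h2.2]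
        rw [← intervalIntegral.integral_add_adjacent_intervals
          (hχ.continuous.intervalIntegrable 0 1) (hχ.continuous.intervalIntegrable 1 x), h0, h2]
        simp
    exact this.trans fun x hx => ⟨hp.trans_le hx.1, hx.2.trans_lt hq⟩

theorem exists_test_integral_eq_one :
    ∃ η : ℝ → ℝ, ContDiff ℝ ∞ η ∧ tsupport η ⊆ Ioo 0 1 ∧ ∫ x, η x ∂vol01 = 1 := by
  let b : ContDiffBump (1 / 2 : ℝ) := ⟨1 / 8, 1 / 4, by norm_num, by norm_num⟩
  have hs : tsupport (b.normed volume) ⊆ Ioo 0 1 := by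
    rw [b.tsupport_normed_eq, Real.closedBall_eq_Icc]
    intro x hx
    have h1 := hx.1
    have h2 := hx.2
    simp only [b] at h1 h2
    constructor <;> linarith
  refine ⟨b.normed volume, b.contDiff_normed, hs, ?_⟩
  rw [setIntegral_eq_integral_of_forall_compl_eq_zero, b.integral_normed]
  exact fun x hx => eq_zero_of_tsupport_subset hs fun h => hx (Ioo_subset_Icc_self h)

/-- The lemma of du Bois-Reymond. -/
theorem exists_ae_eq_const_of_integral_mul_deriv {F : ℝ → ℝ} (hF : Integrable F vol01)
    (h : ∀ φ : ℝ → ℝ, ContDiff ℝ ∞ φ → tsupport φ ⊆ Ioo 0 1 → ∫ x, deriv φ x * F x ∂vol01 = 0) :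
    ∃ D : ℝ, ∀ᵐ x ∂vol01, F x = D := by
  obtain ⟨η, hη, hηs, hη1⟩ := exists_test_integral_eq_one
  have hmul {g : ℝ → ℝ} (hg : Continuous g) : Integrable (fun x => g x * F x) vol01 := by
    obtain ⟨B, hB⟩ := isCompact_Icc.exists_bound_of_continuousOn (s := Icc (0 : ℝ) 1)
      hg.continuousOn
    exact hF.bdd_mul hg.aestronglyMeasurable
      ((ae_restrict_iff' measurableSet_Icc).2 (Filter.Eventually.of_forall hB))
  have hint {g : ℝ → ℝ} (hg : Continuous g) : Integrable g vol01 :=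
    (memLp_of_continuous hg).integrable (by norm_num)
  refine ⟨∫ x, η x * F x ∂vol01, ?_⟩
  set D := ∫ x, η x * F x ∂vol01
  have key : ∀ᵐ x ∂vol01, x ∈ Ioo (0 : ℝ) 1 → F x - D = 0 := by
    refine isOpen_Ioo.ae_eq_zero_of_integral_contDiff_smul_eq_zero
      ((hF.sub (integrable_const D)).locallyIntegrable.locallyIntegrableOn _) fun g hg _ hgs => ?_
    set I := ∫ x, g x ∂vol01
    -- Subtracting `I * η` from `g` makes the mean zero, so the hypothesis can be applied to a
    -- primitive of the difference.
    obtain ⟨φ, hφ, hφs, hφd⟩ := exists_test_primitive (χ := fun x => g x - I * η x)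
      (hg.sub (contDiff_const.mul hη)) (by
        refine closure_minimal (t := tsupport g ∪ tsupport η) (fun x hx => ?_)
          ((isClosed_tsupport g).union (isClosed_tsupport η)) |>.trans (union_subset hgs hηs)
        by_contra hx'
        rw [mem_union, not_or] at hx'
        refine hx ?_
        simp [image_eq_zero_of_notMem_tsupport hx'.1, image_eq_zero_of_notMem_tsupport hx'.2])
      (by
        rw [integral_sub (hint hg.continuous) ((hint hη.continuous).const_mul _),
          integral_const_mul, hη1, mul_one, sub_self])
    have h1 := h φ hφ hφs
    rw [hφd] at h1
    have e1 : (fun x => (g x - I * η x) * F x) = fun x => g x * F x - I * (η x * F x) := by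
      funext x; ring
    rw [e1, integral_sub (hmul hg.continuous) ((hmul hη.continuous).const_mul _),
      integral_const_mul] at h1
    have e2 : (fun x => g x • (F x - D)) = fun x => g x * F x - g x * D := by
      funext x; rw [smul_eq_mul]; ring
    rw [e2, integral_sub (hmul hg.continuous) ((hint hg.continuous).mul_const _),
      integral_mul_const]
    exact h1
  have hio : ∀ᵐ x ∂vol01, x ∈ Ioo (0 : ℝ) 1 := by
    have := ae_restrict_mem (μ := volume) (measurableSet_Ioo (a := (0 : ℝ)) (b := 1))
    rwa [restrict_Ioo_eq_restrict_Icc] at this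
  filter_upwards [key, hio] with x h1 h2
  linarith [h1 h2]

/-! ### Regularity of weak solutions -/

/-- Integrating the constant extension of the one-sided derivative gives a globally `C¹`
coefficient, so later arguments need no derivatives within `[0,1]`. -/
theorem exists_hasDerivAt_extension {a : ℝ → ℝ} (ha : ContDiffOn ℝ 1 a (Icc 0 1)) :
    ∃ b b' : ℝ → ℝ, Continuous b' ∧ (∀ x, HasDerivAt b (b' x) x) ∧ EqOn b a (Icc 0 1) := by
  have hd : ContinuousOn (derivWithin a (Icc 0 1)) (Icc 0 1) :=
    ha.continuousOn_derivWithin (uniqueDiffOn_Icc zero_lt_one) le_rfl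
  let b' : ℝ → ℝ := IccExtend zero_le_one ((Icc (0 : ℝ) 1).domRestrict (derivWithin a (Icc 0 1)))
  have hb' : Continuous b' := (continuousOn_iff_continuous_domRestrict.1 hd).Icc_extend'
  refine ⟨fun x => a 0 + ∫ t in (0 : ℝ)..x, b' t, b', hb', fun x => ?_, fun x hx => ?_⟩
  · exact (intervalIntegral.integral_hasDerivAt_right (hb'.intervalIntegrable _ _)
      (hb'.stronglyMeasurableAtFilter _ _) hb'.continuousAt).const_add _
  · have : ∫ t in (0 : ℝ)..x, b' t = a x - a 0 := by
      refine intervalIntegral.integral_eq_sub_of_hasDerivAt_of_le hx.1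
        (ha.continuousOn.mono (Icc_subset_Icc_right hx.2)) (fun t ht => ?_)
        (hb'.intervalIntegrable _ _)
      have ht' : t ∈ Ioo (0 : ℝ) 1 := ⟨ht.1, ht.2.trans_le hx.2⟩
      have e : b' t = derivWithin a (Icc 0 1) t :=
        IccExtend_of_mem _ _ (Ioo_subset_Icc_self ht')
      rw [e]
      exact ((ha.differentiableOn (by simp)) t (Ioo_subset_Icc_self ht')).hasDerivWithinAt.hasDerivAt
        (Icc_mem_nhds ht'.1 ht'.2)
    simp only [this]
    ring

theorem IsWeakSolution.congr_coeff {ε : ℝ} {a b c d : ℝ → ℝ} (hab : EqOn b a (Icc 0 1))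
    (hcd : EqOn d c (Icc 0 1)) {f u : L2I} (h : IsWeakSolution ε a c f u) :
    IsWeakSolution ε b d f u := by
  obtain ⟨du, hdu, hw⟩ := h
  refine ⟨du, hdu, fun v dv hv => ?_⟩
  have h1 : ∫ x, b x * du x * v x ∂vol01 = ∫ x, a x * du x * v x ∂vol01 :=
    setIntegral_congr_fun measurableSet_Icc fun x hx => by rw [hab hx]
  have h2 : ∫ x, d x * u x * v x ∂vol01 = ∫ x, c x * u x * v x ∂vol01 :=
    setIntegral_congr_fun measurableSet_Icc fun x hx => by rw [hcd hx]
  rw [← hw v dv hv, h1, h2]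

/-- A weak solution with continuous right-hand side is continuously differentiable, and satisfies
the equation integrated once. -/
theorem IsWeakSolution.exists_classical {ε : ℝ} (hε : 0 < ε) {a a' c F : ℝ → ℝ}
    (ha : ∀ x, HasDerivAt a (a' x) x) (ha' : Continuous a') (hc : Continuous c)
    (hF : Continuous F) {f u : L2I} (hf : (f : ℝ → ℝ) =ᵐ[vol01] F)
    (hu : IsWeakSolution ε a c f u) :
    ∃ (U W : ℝ → ℝ) (D : ℝ), Continuous U ∧ Continuous W ∧ (u : ℝ → ℝ) =ᵐ[vol01] U ∧
      U 0 = 0 ∧ U 1 = 0 ∧ (∀ x ∈ Ioo (0 : ℝ) 1, HasDerivAt U (W x) x) ∧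
      ∀ x, ε * W x = a x * U x + D + ∫ t in (0 : ℝ)..x, (c t * U t - F t - a' t * U t) := by
  obtain ⟨du, hdu, hw⟩ := hu
  obtain ⟨hU, hU1⟩ := H01_eq_primitive hdu
  set U := primitive du with hUdef
  have hUc : Continuous U := continuous_primitive_coeFn du
  have hac : Continuous a := continuous_iff_continuousAt.2 fun x => (ha x).continuousAt
  set r : ℝ → ℝ := fun t => c t * U t - F t - a' t * U t with hr
  have hrc : Continuous r := by fun_prop
  set R : ℝ → ℝ := fun x => ∫ t in (0 : ℝ)..x, r t with hR
  have hRd (x : ℝ) : HasDerivAt R (r x) x :=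
    intervalIntegral.integral_hasDerivAt_right (hrc.intervalIntegrable _ _)
      (hrc.stronglyMeasurableAtFilter _ _) hrc.continuousAt
  have hRc : Continuous R := continuous_iff_continuousAt.2 fun x => (hRd x).continuousAt
  have hint {g : ℝ → ℝ} (hg : Continuous g) : Integrable g vol01 :=
    (memLp_of_continuous hg).integrable (by norm_num)
  have hmul {g : ℝ → ℝ} (hg : Continuous g) := integrable_continuous_mul hg du
  -- The equation integrated once: the weak form says that `ε u' - a u - R` has zero weak
  -- derivative.
  obtain ⟨D, hD⟩ : ∃ D : ℝ, ∀ᵐ x ∂vol01, ε * du x - a x * U x - R x = D := by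
    refine exists_ae_eq_const_of_integral_mul_deriv
      ((((integrable_coeFn du).const_mul ε).sub (hint (hac.mul hUc))).sub (hint hRc))
      fun φ hφ hφs => ?_
    have hφc := hφ.continuous
    have hφ'c : Continuous (deriv φ) := hφ.continuous_deriv (by simp)
    have hφd (x : ℝ) : HasDerivAt φ (deriv φ x) x := (hφ.differentiable (by simp) x).hasDerivAt
    have h := hw _ _ (mem_H01_of_test hφ hφs)
    have c1 := MemLp.coeFn_toLp (memLp_of_continuous hφc)
    have c2 := MemLp.coeFn_toLp (memLp_of_continuous hφ'c)
    have i1 : ∫ x, du x * (memLp_of_continuous hφ'c).toLp (deriv φ) x ∂vol01 =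
        ∫ x, deriv φ x * du x ∂vol01 := by
      refine integral_congr_ae ?_
      filter_upwards [c2] with x hx
      rw [hx]; ring
    have i2 : ∫ x, a x * du x * (memLp_of_continuous hφc).toLp φ x ∂vol01 =
        ∫ x, (a x * φ x) * du x ∂vol01 := by
      refine integral_congr_ae ?_
      filter_upwards [c1] with x hx
      rw [hx]; ring
    have i3 : ∫ x, c x * u x * (memLp_of_continuous hφc).toLp φ x ∂vol01 =
        ∫ x, c x * U x * φ x ∂vol01 := by
      refine integral_congr_ae ?_
      filter_upwards [c1, hU] with x hx hx'
      rw [hx, hx']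
    have i4 : ∫ x, f x * (memLp_of_continuous hφc).toLp φ x ∂vol01 =
        ∫ x, F x * φ x ∂vol01 := by
      refine integral_congr_ae ?_
      filter_upwards [c1, hf] with x hx hx'
      rw [hx, hx']
    -- Moving the derivative in `∫ a u' φ` onto `a φ` is what produces the term `a' u` in `r`.
    rw [i1, i2, i3, i4, H01_integral_by_parts hdu (ψ := fun x => a x * φ x)
      (fun x => (ha x).mul (hφd x)) (by fun_prop)] at h
    have i5 : ∫ x, (a' x * φ x + a x * deriv φ x) * u x ∂vol01 =
        ∫ x, (a' x * φ x + a x * deriv φ x) * U x ∂vol01 := by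
      refine integral_congr_ae ?_
      filter_upwards [hU] with x hx
      rw [hx]
    have i6 : ∫ x, deriv φ x * R x ∂vol01 = -∫ x, φ x * r x ∂vol01 := by
      have h' := intervalIntegral.integral_mul_deriv_eq_deriv_mul (a := 0) (b := 1)
        (fun x _ => hφd x) (fun x _ => hRd x) (hφ'c.intervalIntegrable _ _)
        (hrc.intervalIntegrable _ _)
      rw [eq_zero_of_tsupport_subset hφs (by simp : (0 : ℝ) ∉ Ioo (0 : ℝ) 1),
        eq_zero_of_tsupport_subset hφs (by simp : (1 : ℝ) ∉ Ioo (0 : ℝ) 1)] at h'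
      rw [integral_vol01, integral_vol01]
      linarith
    have e1 : (fun x => deriv φ x * (ε * du x - a x * U x - R x)) = fun x =>
        ε * (deriv φ x * du x) - deriv φ x * (a x * U x) - deriv φ x * R x := by
      funext x; ring
    rw [e1, integral_sub, integral_sub, integral_const_mul, i6]
    · rw [i5] at h
      have e2 : (∫ x, (a' x * φ x + a x * deriv φ x) * U x ∂vol01) +
          (∫ x, φ x * r x ∂vol01) - (∫ x, deriv φ x * (a x * U x) ∂vol01) =
          (∫ x, c x * U x * φ x ∂vol01) - ∫ x, F x * φ x ∂vol01 := by
        rw [← integral_add (hint (by fun_prop)) (hint (by fun_prop)),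
          ← integral_sub (hint (by fun_prop)) (hint (by fun_prop)),
          ← integral_sub (hint (by fun_prop)) (hint (by fun_prop))]
        refine integral_congr_ae (Filter.Eventually.of_forall fun x => ?_)
        simp only [hr]
        ring
      linarith
    · exact (hmul hφ'c).const_mul ε
    · exact hint (by fun_prop)
    · exact ((hmul hφ'c).const_mul ε).sub (hint (by fun_prop))
    · exact hint (by fun_prop)
  have hWc : Continuous fun x => (a x * U x + D + R x) / ε := by fun_prop
  have hduW : (du : ℝ → ℝ) =ᵐ[vol01] fun x => (a x * U x + D + R x) / ε := by
    filter_upwards [hD] with x hx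
    rw [eq_div_iff hε.ne']
    linarith
  refine ⟨U, fun x => (a x * U x + D + R x) / ε, D, hUc, hWc, hU, by simp [hUdef, primitive], hU1,
    fun x hx => ?_, fun x => ?_⟩
  · have h1 := intervalIntegral.integral_hasDerivAt_right (hWc.intervalIntegrable 0 x)
      (hWc.stronglyMeasurableAtFilter _ _) hWc.continuousAt
    refine h1.congr_of_eventuallyEq ?_
    filter_upwards [Icc_mem_nhds hx.1 hx.2] with y hy
    exact primitive_eq_of_ae_eq hduW hy
  · exact mul_div_cancel₀ _ hε.ne'

/-! ### A comparison principle for `ε y' = a y - h` -/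

section Comparison

variable {ε : ℝ} {a : ℝ → ℝ}

theorem hasDerivAt_mul_exp_neg_integral (ha : Continuous a) {y : ℝ → ℝ} {y' x : ℝ}
    (hy : HasDerivAt y y' x) :
    HasDerivAt (fun x => y x * Real.exp (-(∫ t in (0 : ℝ)..x, a t) / ε))
      ((y' - a x / ε * y x) * Real.exp (-(∫ t in (0 : ℝ)..x, a t) / ε)) x := by
  have h := intervalIntegral.integral_hasDerivAt_right (ha.intervalIntegrable 0 x)
    (ha.stronglyMeasurableAtFilter _ _) ha.continuousAt
  have h' : HasDerivAt (fun x => -(∫ t in (0 : ℝ)..x, a t) / ε) (-a x / ε) x := h.neg.div_const ε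
  refine (hy.mul h'.exp).congr_deriv ?_
  ring

theorem continuousOn_mul_exp_neg_integral (ha : Continuous a) {y : ℝ → ℝ} {s : Set ℝ}
    (hy : ContinuousOn y s) :
    ContinuousOn (fun x => y x * Real.exp (-(∫ t in (0 : ℝ)..x, a t) / ε)) s := by
  have h : Continuous fun x => ∫ t in (0 : ℝ)..x, a t :=
    intervalIntegral.continuous_primitive (fun _ _ => ha.intervalIntegrable _ _) 0
  exact hy.mul (by fun_prop)

/-- The integrating factor makes `y exp (-∫a / ε)` nonincreasing, so nonnegativity at `x = 1`
propagates to the left. -/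
theorem nonneg_of_mul_deriv_le (hε : 0 < ε) (ha : Continuous a) {y y' : ℝ → ℝ}
    (hy : ContinuousOn y (Icc 0 1)) (hy' : ∀ x ∈ Ioo (0 : ℝ) 1, HasDerivAt y (y' x) x)
    (h : ∀ x ∈ Ioo (0 : ℝ) 1, ε * y' x ≤ a x * y x) (h1 : 0 ≤ y 1) {x : ℝ}
    (hx : x ∈ Icc (0 : ℝ) 1) : 0 ≤ y x := by
  have hanti : AntitoneOn (fun x => y x * Real.exp (-(∫ t in (0 : ℝ)..x, a t) / ε))
      (Icc 0 1) := by
    refine antitoneOn_of_deriv_nonpos (convex_Icc 0 1) (continuousOn_mul_exp_neg_integral ha hy)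
      (fun x hx => ?_) fun x hx => ?_
    · rw [interior_Icc] at hx
      exact (hasDerivAt_mul_exp_neg_integral ha (hy' x hx)).differentiableAt.differentiableWithinAt
    · rw [interior_Icc] at hx
      rw [(hasDerivAt_mul_exp_neg_integral ha (hy' x hx)).deriv]
      refine mul_nonpos_of_nonpos_of_nonneg ?_ (Real.exp_pos _).le
      rw [sub_nonpos, div_mul_eq_mul_div, le_div_iff₀ hε, mul_comm]
      exact h x hx
  have h2 := hanti hx (right_mem_Icc.2 zero_le_one) hx.2
  simp only at h2
  have h3 : 0 ≤ y x * Real.exp (-(∫ t in (0 : ℝ)..x, a t) / ε) :=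
    (mul_nonneg h1 (Real.exp_pos _).le).trans h2
  exact nonneg_of_mul_nonneg_left h3 (Real.exp_pos _)

theorem abs_le_of_barrier (hε : 0 < ε) (ha : Continuous a) {z z' b b' h : ℝ → ℝ}
    (hz : ContinuousOn z (Icc 0 1)) (hz' : ∀ x ∈ Ioo (0 : ℝ) 1, HasDerivAt z (z' x) x)
    (hb : ContinuousOn b (Icc 0 1)) (hb' : ∀ x ∈ Ioo (0 : ℝ) 1, HasDerivAt b (b' x) x)
    (hh : ∀ x ∈ Ioo (0 : ℝ) 1, |ε * z' x - a x * z x| ≤ h x)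
    (hbar : ∀ x ∈ Ioo (0 : ℝ) 1, ε * b' x ≤ a x * b x - h x) (h1 : |z 1| ≤ b 1) {x : ℝ}
    (hx : x ∈ Icc (0 : ℝ) 1) : |z x| ≤ b x := by
  rw [abs_le] at h1 ⊢
  constructor
  · have := nonneg_of_mul_deriv_le hε ha (y := fun x => b x + z x) (hb.add hz)
      (fun x hx => (hb' x hx).add (hz' x hx)) (fun x hx => by
        have := (abs_le.1 (hh x hx)).2
        linarith [hbar x hx]) (by linarith) hx
    linarith
  · have := nonneg_of_mul_deriv_le hε ha (y := fun x => b x - z x) (hb.sub hz)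
      (fun x hx => (hb' x hx).sub (hz' x hx)) (fun x hx => by
        have := (abs_le.1 (hh x hx)).1
        linarith [hbar x hx]) (by linarith) hx
    linarith

/-- If `D > R₀`, then `D + R > 0` and `U exp (-∫a / ε)` is strictly increasing, which contradicts
its vanishing at both ends. Hence the integration constant `D` is bounded independently of `ε`. -/
theorem le_of_boundary_value_problem (hε : 0 < ε) (ha : Continuous a) {U U' R : ℝ → ℝ} {D R₀ : ℝ}
    (hU : ContinuousOn U (Icc 0 1)) (hU' : ∀ x ∈ Ioo (0 : ℝ) 1, HasDerivAt U (U' x) x)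
    (h : ∀ x ∈ Ioo (0 : ℝ) 1, ε * U' x = a x * U x + D + R x)
    (hR : ∀ x ∈ Ioo (0 : ℝ) 1, |R x| ≤ R₀) (h0 : U 0 = 0) (h1 : U 1 = 0) : D ≤ R₀ := by
  by_contra! hD
  have hmono : StrictMonoOn (fun x => U x * Real.exp (-(∫ t in (0 : ℝ)..x, a t) / ε))
      (Icc 0 1) := by
    refine strictMonoOn_of_deriv_pos (convex_Icc 0 1) (continuousOn_mul_exp_neg_integral ha hU)
      fun x hx => ?_
    rw [interior_Icc] at hx
    rw [(hasDerivAt_mul_exp_neg_integral ha (hU' x hx)).deriv]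
    refine mul_pos ?_ (Real.exp_pos _)
    rw [sub_pos, div_mul_eq_mul_div, div_lt_iff₀ hε, mul_comm (U' x), h x hx]
    linarith [(abs_le.1 (hR x hx)).1]
  have := hmono (left_mem_Icc.2 zero_le_one) (right_mem_Icc.2 zero_le_one) zero_lt_one
  simp [h0, h1] at this

theorem abs_le_of_boundary_value_problem (hε : 0 < ε) (ha : Continuous a) {U U' R : ℝ → ℝ}
    {D R₀ : ℝ} (hU : ContinuousOn U (Icc 0 1)) (hU' : ∀ x ∈ Ioo (0 : ℝ) 1, HasDerivAt U (U' x) x)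
    (h : ∀ x ∈ Ioo (0 : ℝ) 1, ε * U' x = a x * U x + D + R x)
    (hR : ∀ x ∈ Ioo (0 : ℝ) 1, |R x| ≤ R₀) (h0 : U 0 = 0) (h1 : U 1 = 0) : |D| ≤ R₀ := by
  rw [abs_le']
  refine ⟨le_of_boundary_value_problem hε ha hU hU' h hR h0 h1,
    le_of_boundary_value_problem hε ha (U := fun x => -U x) (U' := fun x => -U' x)
      (R := fun x => -R x) hU.neg (fun x hx => (hU' x hx).neg) (fun x hx => ?_)
      (fun x hx => by simpa using hR x hx) (by simp [h0]) (by simp [h1])⟩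
  linarith [h x hx]

end Comparison

/-! ### Bounds on the derivatives of solutions -/

/-- The boundary layer function at `x = 1`. -/
noncomputable def layer (α ε x : ℝ) : ℝ := Real.exp (-(α * (1 - x)) / ε)

theorem hasDerivAt_layer (α ε x : ℝ) : HasDerivAt (layer α ε) (α / ε * layer α ε x) x := by
  have h : HasDerivAt (fun x : ℝ => -(α * (1 - x)) / ε) (α / ε) x := by
    refine ((((hasDerivAt_id x).const_sub 1).const_mul α).neg.div_const ε).congr_deriv ?_
    simp
  exact h.exp.congr_deriv (mul_comm _ _)

theorem continuous_layer (α ε : ℝ) : Continuous (layer α ε) :=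
  continuous_iff_continuousAt.2 fun x => (hasDerivAt_layer α ε x).continuousAt

theorem layer_pos (α ε x : ℝ) : 0 < layer α ε x := Real.exp_pos _

theorem layer_one (α ε : ℝ) : layer α ε 1 = 1 := by simp [layer]

/-- Each of `U`, `W = U'` and `Z = U''` solves `ε y' - a y = h`, where `h` is controlled by the
preceding function; a barrier together with the value at `x = 1` then bounds it. -/
theorem exists_second_derivative_bound {a a' c c' : ℝ → ℝ} {α : ℝ} (hα : 0 < α)
    (ha : ∀ x, HasDerivAt a (a' x) x) (ha' : Continuous a')
    (hc : ∀ x, HasDerivAt c (c' x) x) (hc' : Continuous c')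
    (haα : ∀ x ∈ Icc (0 : ℝ) 1, α ≤ a x) {Λ : ℝ} (hΛ : 0 ≤ Λ) :
    ∃ C : ℝ, 0 ≤ C ∧ ∀ ε ∈ Ioc (0 : ℝ) 1, ∀ (F F' : ℝ → ℝ) (Φ : ℝ),
      (∀ x, HasDerivAt F (F' x) x) → (∀ x, |F x| ≤ 2) → (∀ x, |F' x| ≤ Φ) →
      ∀ f u : L2I, (f : ℝ → ℝ) =ᵐ[vol01] F → IsWeakSolution ε a c f u → ‖u‖ ≤ Λ →
      ∃ U W Z : ℝ → ℝ, Continuous U ∧ (u : ℝ → ℝ) =ᵐ[vol01] U ∧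
        (∀ x ∈ Ioo (0 : ℝ) 1, HasDerivAt U (W x) x) ∧
        (∀ x ∈ Ioo (0 : ℝ) 1, HasDerivAt W (Z x) x) ∧
        ∀ x ∈ Ioo (0 : ℝ) 1, |Z x| ≤ C * (1 + Φ) * (1 + layer α ε x / ε ^ 2) := by
  have hac : Continuous a := continuous_iff_continuousAt.2 fun x => (ha x).continuousAt
  have hcc : Continuous c := continuous_iff_continuousAt.2 fun x => (hc x).continuousAt
  obtain ⟨B, hB0, hB⟩ : ∃ B : ℝ, 0 ≤ B ∧ ∀ x ∈ Icc (0 : ℝ) 1,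
      |a x| ≤ B ∧ |a' x| ≤ B ∧ |c x| ≤ B ∧ |c' x| ≤ B := by
    obtain ⟨B, hB⟩ := isCompact_Icc.exists_bound_of_continuousOn (s := Icc (0 : ℝ) 1)
      (f := fun x => |a x| + |a' x| + |c x| + |c' x|) (by fun_prop)
    refine ⟨B, (norm_nonneg _).trans (hB 0 (by simp)), fun x hx => ?_⟩
    have h := (le_abs_self _).trans (hB x hx)
    have h1 := abs_nonneg (a x)
    have h2 := abs_nonneg (a' x)
    have h3 := abs_nonneg (c x)
    have h4 := abs_nonneg (c' x)
    exact ⟨by linarith, by linarith, by linarith, by linarith⟩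
  -- `R₀` bounds `R` and `D`, `U₀` bounds `U`, and `g₀` bounds `c U - F`. `P` and `Q` collect the
  -- regular and the layer part of the differentiated right-hand side, and `S` bounds `ε² |Z 1|`.
  set R₀ := 2 * B * Λ + 2 with hR₀
  set U₀ := 2 * R₀ / α with hU₀
  set g₀ := B * U₀ + 2 with hg₀
  have pR₀ : 0 ≤ R₀ := by positivity
  have pU₀ : 0 ≤ U₀ := by positivity
  have pg₀ : 0 ≤ g₀ := by positivity
  set P := 2 * B * (g₀ / α) + B * U₀ with hP
  set Q := 4 * B * R₀ with hQ
  set S := 2 * B * R₀ + g₀ with hS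
  have pP : 0 ≤ P := by positivity
  have pQ : 0 ≤ Q := by positivity
  have pS : 0 ≤ S := by positivity
  refine ⟨P / α + 1 / α + S + Q, by positivity, ?_⟩
  intro ε hε F F' Φ hF hF2 hFΦ f u hf hu huΛ
  have hε0 := hε.1
  have pΦ : 0 ≤ Φ := (abs_nonneg _).trans (hFΦ 0)
  have hFc : Continuous F := continuous_iff_continuousAt.2 fun x => (hF x).continuousAt
  obtain ⟨U, W, D, hU, hW, huU, hU0, hU1, hUW, hWeq⟩ := hu.exists_classical hε0 ha ha' hcc hFc hf
  have hrc : Continuous fun t => c t * U t - F t - a' t * U t := by fun_prop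
  set R : ℝ → ℝ := fun x => ∫ t in (0 : ℝ)..x, (c t * U t - F t - a' t * U t) with hR
  have hRd (x : ℝ) : HasDerivAt R (c x * U x - F x - a' x * U x) x :=
    intervalIntegral.integral_hasDerivAt_right (hrc.intervalIntegrable _ _)
      (hrc.stronglyMeasurableAtFilter _ _) hrc.continuousAt
  have hint {g : ℝ → ℝ} (hg : Continuous g) : Integrable g vol01 :=
    (memLp_of_continuous hg).integrable (by norm_num)
  have hRb (x : ℝ) (hx : x ∈ Icc (0 : ℝ) 1) : |R x| ≤ R₀ := by
    have h1 : |R x| ≤ ∫ t, |c t * U t - F t - a' t * U t| ∂vol01 := by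
      refine (intervalIntegral.norm_integral_le_integral_norm_uIoc (μ := volume) (a := 0) (b := x)
        (f := fun t => c t * U t - F t - a' t * U t)).trans ?_
      refine setIntegral_mono_set (hint hrc.norm) (Filter.Eventually.of_forall fun _ => norm_nonneg _)
        (Filter.Eventually.of_forall fun t ht => ?_)
      change t ∈ uIoc 0 x at ht
      rw [uIoc_of_le hx.1] at ht
      exact ⟨ht.1.le, ht.2.trans hx.2⟩
    have h2 : ∫ t, |c t * U t - F t - a' t * U t| ∂vol01 ≤ ∫ t, (2 * B * |U t| + 2) ∂vol01 := by
      refine setIntegral_mono_on (hint hrc.abs) (hint (by fun_prop)) measurableSet_Icc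
        fun t ht => ?_
      obtain ⟨-, b2, b3, -⟩ := hB t ht
      have e1 : |c t * U t - F t - a' t * U t| ≤ |c t| * |U t| + |F t| + |a' t| * |U t| := by
        rw [← abs_mul, ← abs_mul]
        exact (abs_sub _ _).trans (add_le_add_left (abs_sub _ _) _)
      have e2 := mul_le_mul_of_nonneg_right b2 (abs_nonneg (U t))
      have e3 := mul_le_mul_of_nonneg_right b3 (abs_nonneg (U t))
      linarith [hF2 t]
    -- The only use of the `L²` stability; all the other bounds follow from this one.
    have h3 : ∫ t, |U t| ∂vol01 ≤ Λ := by
      refine le_trans (le_of_eq ?_) ((integral_abs_le_norm u).trans huΛ)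
      refine integral_congr_ae ?_
      filter_upwards [huU] with t ht
      rw [ht]
    rw [integral_add (hint (by fun_prop)) (hint (by fun_prop)), integral_const_mul] at h2
    simp only [integral_const, probReal_univ, smul_eq_mul, one_mul] at h2
    have := mul_le_mul_of_nonneg_left h3 (by positivity : 0 ≤ 2 * B)
    linarith
  have hD : |D| ≤ R₀ := abs_le_of_boundary_value_problem hε0 hac hU.continuousOn hUW
    (fun x _ => hWeq x) (fun x hx => hRb x (Ioo_subset_Icc_self hx)) hU0 hU1
  have hDR (x : ℝ) (hx : x ∈ Icc (0 : ℝ) 1) : |D + R x| ≤ 2 * R₀ :=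
    (abs_add_le _ _).trans (by linarith [hRb x hx])
  have hUb (x : ℝ) (hx : x ∈ Icc (0 : ℝ) 1) : |U x| ≤ U₀ := by
    refine abs_le_of_barrier hε0 hac (b := fun _ => U₀) (b' := fun _ => 0) (h := fun _ => 2 * R₀)
      hU.continuousOn hUW continuousOn_const (fun _ _ => hasDerivAt_const _ _) (fun x hx => ?_)
      (fun x hx => ?_) (by simpa [hU1] using pU₀) hx
    · rw [hWeq]
      have : a x * U x + D + R x - a x * U x = D + R x := by ring
      rw [this]
      exact hDR x (Ioo_subset_Icc_self hx)
    · have h1 := mul_le_mul_of_nonneg_right (haα x (Ioo_subset_Icc_self hx)) pU₀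
      have h2 : α * U₀ = 2 * R₀ := by rw [hU₀]; field_simp
      linarith
  have hgb (x : ℝ) (hx : x ∈ Icc (0 : ℝ) 1) : |c x * U x - F x| ≤ g₀ := by
    refine (abs_sub _ _).trans ?_
    rw [abs_mul]
    have := mul_le_mul (hB x hx).2.2.1 (hUb x hx) (abs_nonneg _) hB0
    linarith [hF2 x]
  set Z : ℝ → ℝ := fun x => (a x * W x + (c x * U x - F x)) / ε with hZ
  have hZeq (x : ℝ) : ε * Z x = a x * W x + (c x * U x - F x) := mul_div_cancel₀ _ hε0.ne'
  have hWZ (x : ℝ) (hx : x ∈ Ioo (0 : ℝ) 1) : HasDerivAt W (Z x) x := by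
    have h1 : W = fun x => (a x * U x + D + R x) / ε := by
      funext x
      rw [eq_div_iff hε0.ne', ← hWeq x, mul_comm]
    rw [h1]
    refine (((((ha x).mul (hUW x hx)).add_const D).add (hRd x)).div_const ε).congr_deriv ?_
    rw [hZ]
    simp only
    ring
  have hW1 : ε * |W 1| ≤ 2 * R₀ := by
    have h1 := hDR 1 (by simp)
    have h2 := hWeq 1
    rw [hU1, mul_zero, zero_add] at h2
    rwa [← abs_of_pos hε0, ← abs_mul, h2]
  have hlc := continuous_layer α ε
  -- The constant absorbs the source `g₀`. The layer solves `ε b' = α b` exactly and carries the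
  -- boundary value `|W 1| ≤ 2R₀ / ε`.
  have hWb (x : ℝ) (hx : x ∈ Icc (0 : ℝ) 1) : |W x| ≤ g₀ / α + 2 * R₀ / ε * layer α ε x := by
    refine abs_le_of_barrier hε0 hac (z' := Z) (b := fun x => g₀ / α + 2 * R₀ / ε * layer α ε x)
      (b' := fun x => 2 * R₀ / ε * (α / ε * layer α ε x)) (h := fun _ => g₀) hW.continuousOn hWZ
      (by fun_prop) (fun x _ => ((hasDerivAt_layer α ε x).const_mul _).const_add _) (fun x hx => ?_)
      (fun x hx => ?_) ?_ hx
    · rw [hZeq, add_sub_cancel_left]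
      exact hgb x (Ioo_subset_Icc_self hx)
    · have hl := layer_pos α ε x
      have h1 := mul_le_mul_of_nonneg_right (haα x (Ioo_subset_Icc_self hx))
        (by positivity : 0 ≤ g₀ / α + 2 * R₀ / ε * layer α ε x)
      refine le_trans (le_of_eq ?_) (sub_le_sub_right h1 _)
      field_simp
      ring
    · rw [layer_one, mul_one]
      have : |W 1| ≤ 2 * R₀ / ε := by rwa [le_div_iff₀ hε0, mul_comm]
      have : 0 ≤ g₀ / α := by positivity
      linarith
  have hZc : Continuous Z := by fun_prop
  -- The source now contains `Q / ε` times the layer, which is resonant with `ε b' = α b`. This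
  -- forces the factor `1 - x`, as `ε ((1 - x) layer)' = α (1 - x) layer - ε layer`.
  have hZb (x : ℝ) (hx : x ∈ Icc (0 : ℝ) 1) : |Z x| ≤
      (P + Φ) / α + S / ε ^ 2 * layer α ε x + Q / ε ^ 2 * ((1 - x) * layer α ε x) := by
    have hb' (x : ℝ) : HasDerivAt (fun x => (P + Φ) / α + S / ε ^ 2 * layer α ε x +
        Q / ε ^ 2 * ((1 - x) * layer α ε x)) (S / ε ^ 2 * (α / ε * layer α ε x) +
        Q / ε ^ 2 * (-1 * layer α ε x + (1 - x) * (α / ε * layer α ε x))) x :=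
      (((hasDerivAt_layer α ε x).const_mul _).const_add _).add
        ((((hasDerivAt_id x).const_sub 1).mul (hasDerivAt_layer α ε x)).const_mul _)
    refine abs_le_of_barrier hε0 hac
      (z' := fun x => (a' x * W x + a x * Z x + (c' x * U x + c x * W x - F' x)) / ε)
      (h := fun x => P + Φ + Q / ε * layer α ε x) hZc.continuousOn (fun x hx => ?_)
      (by fun_prop) (fun x _ => hb' x) (fun x hx => ?_) (fun x hx => ?_) ?_ hx
    · exact (((ha x).mul (hWZ x hx)).add (((hc x).mul (hUW x hx)).sub (hF x))).div_const ε
    · rw [mul_div_cancel₀ _ hε0.ne']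
      have hx' := Ioo_subset_Icc_self hx
      obtain ⟨-, b2, b3, b4⟩ := hB x hx'
      have e : a' x * W x + a x * Z x + (c' x * U x + c x * W x - F' x) - a x * Z x =
          (a' x * W x + c x * W x) + (c' x * U x - F' x) := by ring
      rw [e]
      have k1 := mul_le_mul b2 (hWb x hx') (abs_nonneg _) hB0
      have k2 := mul_le_mul b3 (hWb x hx') (abs_nonneg _) hB0
      have k3 := mul_le_mul b4 (hUb x hx') (abs_nonneg _) hB0
      rw [← abs_mul] at k1 k2 k3
      have k4 := abs_add_le (a' x * W x + c x * W x) (c' x * U x - F' x)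
      have k5 := abs_add_le (a' x * W x) (c x * W x)
      have k6 := abs_sub (c' x * U x) (F' x)
      have k7 : P + Φ + Q / ε * layer α ε x = 2 * (B * (g₀ / α + 2 * R₀ / ε * layer α ε x)) +
        B * U₀ + Φ := by rw [hP, hQ]; ring
      rw [k7]
      linarith [hFΦ x]
    · have hl := layer_pos α ε x
      have hx1 : 0 ≤ 1 - x := by linarith [hx.2]
      have h1 := mul_le_mul_of_nonneg_right (haα x (Ioo_subset_Icc_self hx))
        (by positivity : 0 ≤ (P + Φ) / α + S / ε ^ 2 * layer α ε x +
          Q / ε ^ 2 * ((1 - x) * layer α ε x))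
      refine le_trans (le_of_eq ?_) (sub_le_sub_right h1 _)
      field_simp
      ring
    · have h0 : 0 ≤ (P + Φ) / α := by positivity
      simp only [layer_one, sub_self, mul_zero, add_zero, mul_one]
      have h1 : |Z 1| ≤ S / ε ^ 2 := by
        rw [le_div_iff₀ (by positivity)]
        have k1 : ε * |Z 1| = |a 1 * W 1 + (c 1 * U 1 - F 1)| := by
          rw [← hZeq, abs_mul, abs_of_pos hε0]
        have k2 := abs_add_le (a 1 * W 1) (c 1 * U 1 - F 1)
        have k3 := hgb 1 (by simp)
        have k4 : ε * |a 1 * W 1| ≤ B * (2 * R₀) := by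
          rw [abs_mul, mul_left_comm]
          exact mul_le_mul (hB 1 (by simp)).1 hW1 (by positivity) hB0
        have k5 : ε * |c 1 * U 1 - F 1| ≤ g₀ := by
          calc ε * |c 1 * U 1 - F 1| ≤ 1 * g₀ := mul_le_mul hε.2 k3 (abs_nonneg _) zero_le_one
            _ = g₀ := one_mul _
        calc |Z 1| * ε ^ 2 = ε * (ε * |Z 1|) := by ring
          _ ≤ ε * (|a 1 * W 1| + |c 1 * U 1 - F 1|) := by
            rw [k1]; exact mul_le_mul_of_nonneg_left k2 hε0.le
          _ ≤ S := by rw [hS]; linarith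
      linarith
  refine ⟨U, W, Z, hU, huU, hUW, hWZ, fun x hx => (hZb x (Ioo_subset_Icc_self hx)).trans ?_⟩
  have hl : 0 ≤ layer α ε x / ε ^ 2 := div_nonneg (layer_pos α ε x).le (by positivity)
  have hx1 : 1 - x ≤ 1 := by linarith [hx.1]
  have hx0 : 0 ≤ 1 - x := by linarith [hx.2]
  set E := layer α ε x / ε ^ 2 with hE
  have e1 : (P + Φ) / α + S / ε ^ 2 * layer α ε x + Q / ε ^ 2 * ((1 - x) * layer α ε x) =
      P / α + 1 / α * Φ + S * E + Q * E * (1 - x) := by rw [hE]; ring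
  have e2 : Q * E * (1 - x) ≤ Q * E := mul_le_of_le_one_right (by positivity) hx1
  have e3 : (P / α + 1 / α + S + Q) * (1 + Φ) * (1 + E) - (P / α + 1 / α * Φ + S * E + Q * E) =
      P / α * (Φ + E + Φ * E) + 1 / α * (1 + E + Φ * E) + (S + Q) * (1 + Φ + Φ * E) := by ring
  have e4 : 0 ≤ P / α * (Φ + E + Φ * E) + 1 / α * (1 + E + Φ * E) + (S + Q) * (1 + Φ + Φ * E) := by
    positivity
  linarith

/-! ### Piecewise linear interpolation on a mesh adapted to the layer -/

/-- The function `κ/2 (Ψ - Ψ p)² + U` is convex, because its second derivative is at least `κ ψ² + Z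
≥ 0`; so it lies below its chord. The interpolation error thus depends only on the increment of `Ψ`
over the cell, however sharply `U''` varies there. -/
theorem sub_chord_le {U W Z Ψ ψ ψ' : ℝ → ℝ} {κ p q : ℝ} (hκ : 0 ≤ κ) (hpq : p < q)
    (hU : ContinuousOn U (Icc p q)) (hUW : ∀ x ∈ Ioo p q, HasDerivAt U (W x) x)
    (hWZ : ∀ x ∈ Ioo p q, HasDerivAt W (Z x) x) (hΨ : ∀ x, HasDerivAt Ψ (ψ x) x)
    (hψ : ∀ x, HasDerivAt ψ (ψ' x) x) (hψ₀ : ∀ x, 0 ≤ ψ x) (hψ'₀ : ∀ x, 0 ≤ ψ' x)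
    (hZ : ∀ x ∈ Ioo p q, |Z x| ≤ κ * ψ x ^ 2) {x : ℝ} (hx : x ∈ Icc p q) :
    U x - (U p + (U q - U p) / (q - p) * (x - p)) ≤ κ / 2 * (Ψ q - Ψ p) ^ 2 := by
  have hΨc : Continuous Ψ := continuous_iff_continuousAt.2 fun x => (hΨ x).continuousAt
  have hmono : Monotone Ψ := monotone_of_deriv_nonneg (fun x => (hΨ x).differentiableAt)
    fun x => by rw [(hΨ x).deriv]; exact hψ₀ x
  have hconv : ConvexOn ℝ (Icc p q) (fun x => κ / 2 * (Ψ x - Ψ p) ^ 2 + U x) := by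
    refine convexOn_of_hasDerivWithinAt2_nonneg (convex_Icc p q)
      (f' := fun x => κ * ((Ψ x - Ψ p) * ψ x) + W x)
      (f'' := fun x => κ * (ψ x * ψ x + (Ψ x - Ψ p) * ψ' x) + Z x)
      ((Continuous.continuousOn (by fun_prop)).add hU) ?_ ?_ ?_ <;> rw [interior_Icc] <;>
      intro x hx
    · refine HasDerivAt.hasDerivWithinAt ?_
      refine (((((hΨ x).sub_const (Ψ p)).pow 2).const_mul (κ / 2)).add (hUW x hx)).congr_deriv ?_
      simp only [Nat.cast_ofNat, Nat.add_one_sub_one, pow_one]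
      ring
    · exact (((((hΨ x).sub_const (Ψ p)).mul (hψ x)).const_mul κ).add (hWZ x hx)).hasDerivWithinAt
    · have h1 := (abs_le.1 (hZ x hx)).1
      have h2 : 0 ≤ κ * ((Ψ x - Ψ p) * ψ' x) :=
        mul_nonneg hκ (mul_nonneg (sub_nonneg.2 (hmono hx.1.le)) (hψ'₀ x))
      nlinarith
  have hd : 0 < q - p := sub_pos.2 hpq
  have h := hconv.2 (left_mem_Icc.2 hpq.le) (right_mem_Icc.2 hpq.le)
    (div_nonneg (sub_nonneg.2 hx.2) hd.le) (div_nonneg (sub_nonneg.2 hx.1) hd.le)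
    (by field_simp; ring)
  simp only [smul_eq_mul] at h
  have e1 : (q - x) / (q - p) * p + (x - p) / (q - p) * q = x := by field_simp; ring
  rw [e1] at h
  have e2 : (q - x) / (q - p) * (κ / 2 * (Ψ p - Ψ p) ^ 2 + U p) +
      (x - p) / (q - p) * (κ / 2 * (Ψ q - Ψ p) ^ 2 + U q) =
      (x - p) / (q - p) * (κ / 2 * (Ψ q - Ψ p) ^ 2) +
        (U p + (U q - U p) / (q - p) * (x - p)) := by
    field_simp; ring
  rw [e2] at h
  have e3 : (x - p) / (q - p) * (κ / 2 * (Ψ q - Ψ p) ^ 2) ≤ κ / 2 * (Ψ q - Ψ p) ^ 2 :=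
    mul_le_of_le_one_left (by positivity) (by rw [div_le_one hd]; linarith [hx.2])
  have e4 : 0 ≤ κ / 2 * (Ψ x - Ψ p) ^ 2 := by positivity
  linarith

theorem abs_sub_chord_le {U W Z Ψ ψ ψ' : ℝ → ℝ} {κ p q : ℝ} (hκ : 0 ≤ κ) (hpq : p < q)
    (hU : ContinuousOn U (Icc p q)) (hUW : ∀ x ∈ Ioo p q, HasDerivAt U (W x) x)
    (hWZ : ∀ x ∈ Ioo p q, HasDerivAt W (Z x) x) (hΨ : ∀ x, HasDerivAt Ψ (ψ x) x)
    (hψ : ∀ x, HasDerivAt ψ (ψ' x) x) (hψ₀ : ∀ x, 0 ≤ ψ x) (hψ'₀ : ∀ x, 0 ≤ ψ' x)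
    (hZ : ∀ x ∈ Ioo p q, |Z x| ≤ κ * ψ x ^ 2) {x : ℝ} (hx : x ∈ Icc p q) :
    |U x - (U p + (U q - U p) / (q - p) * (x - p))| ≤ κ / 2 * (Ψ q - Ψ p) ^ 2 := by
  refine abs_le'.2 ⟨sub_chord_le hκ hpq hU hUW hWZ hΨ hψ hψ₀ hψ'₀ hZ hx, ?_⟩
  have h := sub_chord_le (U := fun x => -U x) (W := fun x => -W x) (Z := fun x => -Z x) hκ hpq
    hU.neg (fun x hx => (hUW x hx).neg) (fun x hx => (hWZ x hx).neg) hΨ hψ hψ₀ hψ'₀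
    (fun x hx => by rw [abs_neg]; exact hZ x hx) hx
  refine le_trans (le_of_eq ?_) h
  ring

/-- The mesh generating function, whose derivative is `1 + ε⁻¹ exp (-α (1 - x) / (2ε))`. -/
noncomputable def meshFunction (α ε x : ℝ) : ℝ := x + 2 / α * layer α (2 * ε) x

section Mesh

variable {α ε : ℝ}

theorem hasDerivAt_meshFunction (hα : 0 < α) (x : ℝ) :
    HasDerivAt (meshFunction α ε) (1 + layer α (2 * ε) x / ε) x := by
  refine ((hasDerivAt_id x).add ((hasDerivAt_layer α (2 * ε) x).const_mul (2 / α))).congr_deriv ?_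
  field_simp

theorem hasDerivAt_meshFunction_deriv (x : ℝ) :
    HasDerivAt (fun x => 1 + layer α (2 * ε) x / ε) (α / (2 * ε) * layer α (2 * ε) x / ε) x :=
  ((hasDerivAt_layer α (2 * ε) x).div_const ε).const_add 1

/-- The layer of width `2ε` is the square root of the layer of width `ε`; hence the doubled width in
`meshFunction`. -/
theorem one_add_layer_le (hε : 0 < ε) (x : ℝ) :
    1 + layer α ε x / ε ^ 2 ≤ (1 + layer α (2 * ε) x / ε) ^ 2 := by
  have h : layer α ε x = layer α (2 * ε) x ^ 2 := by
    unfold layer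
    rw [← Real.exp_nat_mul]
    congr 1
    push_cast
    field_simp
  have h2 : 0 ≤ layer α (2 * ε) x / ε := div_nonneg (layer_pos _ _ _).le hε.le
  rw [h, ← div_pow]
  nlinarith

/-- The knots equidistribute `meshFunction`, whose total increment on `[0,1]` is at most `1 + 2 / α`
for every `ε`. -/
theorem exists_mesh (hα : 0 < α) (hε : 0 < ε) {N : ℕ} (hN : N ≠ 0) :
    ∃ x : ℕ → ℝ, StrictMono x ∧ x 0 = 0 ∧ x N = 1 ∧
      ∀ i, (meshFunction α ε (x (i + 1)) - meshFunction α ε (x i)) ^ 2 ≤ ((1 + 2 / α) / N) ^ 2 := by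
  have hpos (x : ℝ) : 0 < 1 + layer α (2 * ε) x / ε := by
    have := div_pos (layer_pos α (2 * ε) x) hε
    linarith
  have hmono : StrictMono (meshFunction α ε) := strictMono_of_deriv_pos fun x => by
    rw [(hasDerivAt_meshFunction hα x).deriv]; exact hpos x
  have hcont : Continuous (meshFunction α ε) :=
    continuous_iff_continuousAt.2 fun x => (hasDerivAt_meshFunction hα x).continuousAt
  have hsurj : Function.Surjective (meshFunction α ε) := by
    refine hcont.surjective ?_ ?_
    · refine Filter.tendsto_atTop_mono (fun x => ?_) Filter.tendsto_id
      have := layer_pos α (2 * ε) x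
      have : 0 ≤ 2 / α * layer α (2 * ε) x := by positivity
      simp only [meshFunction, id]
      linarith
    · refine Filter.tendsto_atBot_mono' _ ?_
        (Filter.tendsto_atBot_add_const_right _ (2 / α) Filter.tendsto_id)
      filter_upwards [Filter.eventually_le_atBot (1 : ℝ)] with x hx
      have : layer α (2 * ε) x ≤ 1 := by
        unfold layer
        rw [Real.exp_le_one_iff]
        refine div_nonpos_of_nonpos_of_nonneg ?_ (by positivity)
        have := mul_nonneg hα.le (sub_nonneg.2 hx)
        linarith
      have := mul_le_of_le_one_right (by positivity : 0 ≤ 2 / α) this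
      simp only [meshFunction, id]
      linarith
  have hN' : (0 : ℝ) < N := by exact_mod_cast Nat.pos_of_ne_zero hN
  set η := (meshFunction α ε 1 - meshFunction α ε 0) / N with hη
  have hη0 : 0 < η := div_pos (sub_pos.2 (hmono zero_lt_one)) hN'
  choose x hx using fun i : ℕ => hsurj (meshFunction α ε 0 + i * η)
  refine ⟨x, fun i j hij => ?_, ?_, ?_, fun i => ?_⟩
  · rw [← hmono.lt_iff_lt, hx, hx]
    have : (i : ℝ) < j := by exact_mod_cast hij
    nlinarith
  · apply hmono.injective
    rw [hx]; simp
  · apply hmono.injective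
    rw [hx, hη]; field_simp; ring
  · have e : meshFunction α ε (x (i + 1)) - meshFunction α ε (x i) = η := by
      rw [hx, hx]; push_cast; ring
    rw [e]
    refine pow_le_pow_left₀ hη0.le ?_ 2
    rw [hη]
    gcongr
    have h0 := layer_pos α (2 * ε) 0
    have : 0 ≤ 2 / α * layer α (2 * ε) 0 := by positivity
    simp only [meshFunction, layer_one, mul_one, zero_add]
    linarith

theorem exists_mem_subinterval {x : ℕ → ℝ} {t : ℝ} (h0 : x 0 ≤ t) (N : ℕ) (hN : t ≤ x (N + 1)) :
    ∃ j < N + 1, t ∈ Icc (x j) (x (j + 1)) := by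
  induction N with
  | zero => exact ⟨0, by omega, h0, hN⟩
  | succ N ih =>
    rcases le_total t (x (N + 1)) with h | h
    · obtain ⟨j, hj, hjt⟩ := ih h
      exact ⟨j, by omega, hjt⟩
    · exact ⟨N + 1, by omega, h, hN⟩

end Mesh

/-- Functions whose second derivatives have a layer at `1` are simultaneously approximated by a
trunk net with `N + 1` hidden neurons to accuracy `O (N⁻²)`, uniformly in the layer width `ε`. -/
theorem exists_trunk {α ε κ : ℝ} (hα : 0 < α) (hε : 0 < ε) (hκ : 0 ≤ κ) {N p : ℕ} (hN : N ≠ 0)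
    {v : Fin p → L2I} {U W Z : Fin p → ℝ → ℝ} (hU : ∀ k, Continuous (U k))
    (hv : ∀ k, (v k : ℝ → ℝ) =ᵐ[vol01] U k)
    (hUW : ∀ k, ∀ x ∈ Ioo (0 : ℝ) 1, HasDerivAt (U k) (W k x) x)
    (hWZ : ∀ k, ∀ x ∈ Ioo (0 : ℝ) 1, HasDerivAt (W k) (Z k x) x)
    (hZ : ∀ k, ∀ x ∈ Ioo (0 : ℝ) 1, |Z k x| ≤ κ * (1 + layer α ε x / ε ^ 2)) :
    ∃ τ : ReLUNet 1 (p + 1), τ.hiddenSize = N + 1 ∧ (∀ x, τ.eval (fun _ => x) 0 = 0) ∧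
      ∀ k, ‖v k - trunkLp τ k‖ ≤ κ / 2 * ((1 + 2 / α) / N) ^ 2 := by
  obtain ⟨x, hx, hx0, hxN, hxΨ⟩ := exists_mesh hα hε hN
  refine ⟨interpolationNet N x fun k i => U k (x i), hiddenSize_interpolationNet _ _ _,
    interpolationNet_eval_zero _ _ _, fun k => norm_le_of_ae_abs_le (by positivity) ?_⟩
  have h1 : (trunkLp (interpolationNet N x fun k i => U k (x i)) k : ℝ → ℝ) =ᵐ[vol01]
      fun t => (interpolationNet N x fun k i => U k (x i)).eval (fun _ => t) k.succ :=
    MemLp.coeFn_toLp _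
  filter_upwards [Lp.coeFn_sub (v k) (trunkLp (interpolationNet N x fun k i => U k (x i)) k),
    h1, hv k, ae_restrict_mem measurableSet_Icc] with t e1 e2 e3 ht
  rw [e1, Pi.sub_apply, e2, e3]
  obtain ⟨N, rfl⟩ := Nat.exists_eq_succ_of_ne_zero hN
  obtain ⟨j, hj, hjt⟩ := exists_mem_subinterval (hx0.trans_le ht.1) N (ht.2.trans_eq hxN.symm)
  have hsub : Ioo (x j) (x (j + 1)) ⊆ Ioo 0 1 := by
    rw [← hx0, ← hxN]
    exact Ioo_subset_Ioo (hx.monotone (Nat.zero_le _)) (hx.monotone hj)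
  rw [interpolationNet_eval_of_mem hx _ hj hjt]
  refine (abs_sub_chord_le hκ (hx (Nat.lt_succ_self j)) (hU k).continuousOn
    (fun y hy => hUW k y (hsub hy)) (fun y hy => hWZ k y (hsub hy))
    (hasDerivAt_meshFunction (ε := ε) hα) hasDerivAt_meshFunction_deriv
    (fun y => ?_) (fun y => ?_) (fun y hy => ?_) hjt).trans ?_
  · have := layer_pos α (2 * ε) y
    positivity
  · have := layer_pos α (2 * ε) y
    positivity
  · exact (hZ k y (hsub hy)).trans (mul_le_mul_of_nonneg_left (one_add_layer_le hε y) hκ)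
  · exact mul_le_mul_of_nonneg_left (hxΨ j) (by positivity)

/-! ### Linearity of the solution operator -/

theorem integrable_mul_mul {g : ℝ → ℝ} (hg : Continuous g) (f h : L2I) :
    Integrable (fun x => g x * f x * h x) vol01 := by
  obtain ⟨B, hB⟩ := isCompact_Icc.exists_bound_of_continuousOn (s := Icc (0 : ℝ) 1)
    hg.continuousOn
  have h1 : Integrable (fun x => f x * h x) vol01 := (Lp.memLp f).integrable_mul (Lp.memLp h)
  refine (h1.bdd_mul hg.aestronglyMeasurable
    ((ae_restrict_iff' measurableSet_Icc).2 (Filter.Eventually.of_forall hB))).congr ?_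
  exact Filter.Eventually.of_forall fun x => (mul_assoc _ _ _).symm

theorem integral_mul_add_mul {g : ℝ → ℝ} (hg : Continuous g) (f f' h : L2I) :
    ∫ x, g x * (f + f' : L2I) x * h x ∂vol01 =
      (∫ x, g x * f x * h x ∂vol01) + ∫ x, g x * f' x * h x ∂vol01 := by
  rw [← integral_add (integrable_mul_mul hg f h) (integrable_mul_mul hg f' h)]
  refine integral_congr_ae ?_
  filter_upwards [Lp.coeFn_add f f'] with x hx
  rw [hx, Pi.add_apply]; ring

theorem integral_mul_smul_mul (g : ℝ → ℝ) (r : ℝ) (f h : L2I) :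
    ∫ x, g x * (r • f : L2I) x * h x ∂vol01 = r * ∫ x, g x * f x * h x ∂vol01 := by
  rw [← integral_const_mul]
  refine integral_congr_ae ?_
  filter_upwards [Lp.coeFn_smul r f] with x hx
  rw [hx, Pi.smul_apply, smul_eq_mul]; ring

theorem IsWeakSolution.add {ε : ℝ} {a c : ℝ → ℝ} (ha : Continuous a) (hc : Continuous c)
    {f f' u u' : L2I} (h : IsWeakSolution ε a c f u) (h' : IsWeakSolution ε a c f' u') :
    IsWeakSolution ε a c (f + f') (u + u') := by
  obtain ⟨du, hdu, hw⟩ := h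
  obtain ⟨du', hdu', hw'⟩ := h'
  refine ⟨du + du', H01_add hdu hdu', fun v dv hv => ?_⟩
  have e1 := integral_mul_add_mul (g := fun _ => 1) continuous_const du du' dv
  have e2 := integral_mul_add_mul (g := fun _ => 1) continuous_const f f' v
  simp only [one_mul] at e1 e2
  rw [e1, e2, integral_mul_add_mul ha, integral_mul_add_mul hc, ← hw v dv hv, ← hw' v dv hv]
  ring

theorem IsWeakSolution.smul {ε : ℝ} {a c : ℝ → ℝ} (r : ℝ) {f u : L2I}
    (h : IsWeakSolution ε a c f u) : IsWeakSolution ε a c (r • f) (r • u) := by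
  obtain ⟨du, hdu, hw⟩ := h
  refine ⟨r • du, H01_smul r hdu, fun v dv hv => ?_⟩
  have e1 := integral_mul_smul_mul (fun _ => 1) r du dv
  have e2 := integral_mul_smul_mul (fun _ => 1) r f v
  simp only [one_mul] at e1 e2
  rw [e1, e2, integral_mul_smul_mul, integral_mul_smul_mul, ← hw v dv hv]
  ring

/-- Linearity comes from uniqueness: sums and multiples of weak solutions are weak solutions of the
combined data. The Lipschitz constant then becomes the operator norm bound. -/
theorem IsSolutionOperator.exists_continuousLinearMap {ε : ℝ} {a c b d : ℝ → ℝ}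
    (hb : Continuous b) (hd : Continuous d) (hba : EqOn b a (Icc 0 1)) (hdc : EqOn d c (Icc 0 1))
    {G : L2I → L2I} (hG : IsSolutionOperator ε a c G) {Λ : ℝ≥0} (hΛ : LipschitzWith Λ G) :
    ∃ T : L2I →L[ℝ] L2I, (∀ f, T f = G f) ∧ ‖T‖ ≤ Λ ∧ ∀ f, IsWeakSolution ε b d f (G f) := by
  have hw (f : L2I) : IsWeakSolution ε b d f (G f) :=
    ((hG f (G f)).2 rfl).congr_coeff hba hdc
  have hu {f u : L2I} (h : IsWeakSolution ε b d f u) : u = G f :=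
    (hG f u).1 (h.congr_coeff hba.symm hdc.symm)
  let T : L2I →ₗ[ℝ] L2I :=
    { toFun := G
      map_add' := fun f g => (hu ((hw f).add hb hd (hw g))).symm
      map_smul' := fun r f => (hu ((hw f).smul r)).symm }
  have hT (f : L2I) : ‖T f‖ ≤ Λ * ‖f‖ := by
    have h := hΛ.dist_le_mul f 0
    rwa [show G 0 = 0 from T.map_zero, dist_zero_right, dist_zero_right] at h
  exact ⟨T.mkContinuous Λ hT, fun f => rfl, T.mkContinuous_norm_le Λ.2 hT, hw⟩

/-! ### The trunk net and its size -/

/-- Since `2 / (2 - γ) ≥ 1`, already `N² ≥ p ^ (n + 1)`; the extra power of `p` pays for the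
derivative of the highest frequency. -/
theorem rpow_accuracy {n γ : ℝ} (hn : 0 < n) (hγ : γ ∈ Ioo (0 : ℝ) 1) {p N : ℝ} (hp : 1 ≤ p)
    (hN : p ^ ((n + 1) / (2 - γ)) ≤ N) : p / N ^ 2 ≤ p ^ (-n) := by
  have hp0 : 0 < p := by linarith
  have h2γ : 0 < 2 - γ := by linarith [hγ.2]
  have h1 : p ^ (n + 1) ≤ N ^ 2 := by
    calc p ^ (n + 1) ≤ p ^ ((n + 1) / (2 - γ) * (2 : ℕ)) := by
          refine Real.rpow_le_rpow_of_exponent_le hp ?_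
          rw [div_mul_eq_mul_div, le_div_iff₀ h2γ]
          push_cast
          exact mul_le_mul_of_nonneg_left (by linarith [hγ.1]) (by linarith)
      _ = (p ^ ((n + 1) / (2 - γ))) ^ 2 := Real.rpow_mul_natCast hp0.le _ _
      _ ≤ N ^ 2 := pow_le_pow_left₀ (Real.rpow_nonneg hp0.le _) hN 2
  calc p / N ^ 2 ≤ p / p ^ (n + 1) := div_le_div_of_nonneg_left hp0.le (by positivity) h1
    _ = p ^ (-n) := by
      rw [Real.rpow_neg hp0.le, Real.rpow_add hp0, Real.rpow_one]
      field_simp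

theorem exists_trunk_of_isWeakSolution {a a' c c' : ℝ → ℝ} {α : ℝ} (hα : 0 < α)
    (ha : ∀ x, HasDerivAt a (a' x) x) (ha' : Continuous a')
    (hc : ∀ x, HasDerivAt c (c' x) x) (hc' : Continuous c')
    (haα : ∀ x ∈ Icc (0 : ℝ) 1, α ≤ a x) {Λ : ℝ} (hΛ : 0 ≤ Λ) {n γ : ℝ} (hn : 0 < n)
    (hγ : γ ∈ Ioo (0 : ℝ) 1) :
    ∃ C : ℝ, 0 ≤ C ∧ ∀ ε ∈ Ioc (0 : ℝ) 1, ∀ p K : ℕ, p = 2 * K + 1 → ∀ v : Fin p → L2I,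
      (∀ k : Fin p, IsWeakSolution ε a c (hartleyLp ((k : ℕ) - K)) (v k)) → (∀ k, ‖v k‖ ≤ Λ) →
      ∃ τ : ReLUNet 1 (p + 1), (τ.hiddenSize : ℝ) ≤ (p : ℝ) ^ ((n + 1) / (2 - γ)) + 2 ∧
        (∀ x, τ.eval (fun _ => x) 0 = 0) ∧ ∀ k, ‖v k - trunkLp τ k‖ ≤ C * (p : ℝ) ^ (-n) := by
  obtain ⟨C, hC, hb⟩ := exists_second_derivative_bound hα ha ha' hc hc' haα hΛ
  refine ⟨4 * C * (1 + 2 / α) ^ 2, by positivity, ?_⟩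
  intro ε hε p K hp v hv hvΛ
  have hp1 : (1 : ℝ) ≤ p := by
    have : 1 ≤ p := by omega
    exact_mod_cast this
  choose U W Z hU hvU hUW hWZ hZ using fun k : Fin p =>
    hb ε hε (hartley ((k : ℕ) - K)) _ _ (hasDerivAt_hartley _) (abs_hartley_le _)
      (abs_deriv_hartley_le _) _ _ (coeFn_hartleyLp _) (hv k) (hvΛ k)
  set r := (p : ℝ) ^ ((n + 1) / (2 - γ)) with hr
  have hr0 : 0 < r := Real.rpow_pos_of_pos (by linarith) _
  have hN : ⌈r⌉₊ ≠ 0 := (Nat.ceil_pos.2 hr0).ne'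
  -- The input `hartley k` with `|k| ≤ p / 2` has slope at most `4π|k| ≤ 7p`, so `1 + Φ ≤ 8p`.
  obtain ⟨τ, h1, h2, h3⟩ := exists_trunk (κ := 8 * C * p) hα hε.1 (by positivity) hN hU hvU hUW hWZ
    fun k x hx => by
      refine (hZ k x hx).trans ?_
      have hl : 0 < layer α ε x / ε ^ 2 := div_pos (layer_pos _ _ _) (pow_pos hε.1 2)
      refine mul_le_mul_of_nonneg_right ?_ (by linarith)
      have hk : |(((k : ℕ) - K : ℤ) : ℝ)| ≤ p / 2 := by
        have h1 : (k : ℝ) ≤ 2 * K := by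
          have : (k : ℕ) ≤ 2 * K := by omega
          exact_mod_cast this
        have h2 : (p : ℝ) = 2 * K + 1 := by rw [hp]; push_cast; ring
        have h3 : (0 : ℝ) ≤ k := Nat.cast_nonneg _
        push_cast
        rw [abs_le]
        constructor <;> linarith
      have h4 : 4 * Real.pi * |(((k : ℕ) - K : ℤ) : ℝ)| ≤ 4 * 3.5 * (p / 2) := by
        gcongr
        linarith [Real.pi_lt_d2]
      have h5 : 1 + 4 * Real.pi * |(((k : ℕ) - K : ℤ) : ℝ)| ≤ 8 * p := by linarith
      calc C * (1 + 4 * Real.pi * |(((k : ℕ) - K : ℤ) : ℝ)|) ≤ C * (8 * p) := by gcongr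
        _ = 8 * C * p := by ring
  refine ⟨τ, ?_, h2, fun k => (h3 k).trans ?_⟩
  · rw [h1]
    push_cast
    linarith [Nat.ceil_lt_add_one hr0.le]
  · have h4 := rpow_accuracy hn hγ hp1 (Nat.le_ceil r)
    calc 8 * C * p / 2 * ((1 + 2 / α) / (⌈r⌉₊ : ℝ)) ^ 2
        = 4 * C * (1 + 2 / α) ^ 2 * (p / (⌈r⌉₊ : ℝ) ^ 2) := by ring
      _ ≤ _ := mul_le_mul_of_nonneg_left h4 (by positivity)

end SPP

/-! ### Assembly of the error and size bounds -/

theorem theorem3p2 (a c : ℝ → ℝ) (α : ℝ) (hα : 0 < α)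
    (ha : ContDiffOn ℝ 1 a (Icc 0 1)) (hc : ContDiffOn ℝ 1 c (Icc 0 1))
    (haα : ∀ x ∈ Icc (0 : ℝ) 1, α ≤ a x)
    (Λ : ℝ≥0) (l₀ : ℝ) (n : ℝ) (hn : 0 < n) (γ : ℝ) (hγ : γ ∈ Ioo (0 : ℝ) 1) :
    ∃ C : ℝ, 0 < C ∧
      ∀ ε ∈ Ioc (0 : ℝ) 1,
      ∀ G : SPP.L2I → SPP.L2I, SPP.IsSolutionOperator ε a c G → LipschitzWith Λ G →
      ∀ l ∈ Ioc 0 l₀, ∀ μ : Measure SPP.L2I, SPP.IsPeriodicRBFGaussian l μ →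
      ∀ m p M K : ℕ, m = 2 * M + 1 → p = 2 * K + 1 →
      ∃ (β : SPP.ReLUNet m p) (τ : SPP.ReLUNet 1 (p + 1)),
        (β.size : ℝ) ≤ C * max (m : ℝ) (p : ℝ) ∧
        (τ.hiddenSize : ℝ) ≤ C * (p : ℝ) ^ ((n + 1) / (2 - γ)) ∧
        (τ.size : ℝ) ≤ C * max (p : ℝ) ((p : ℝ) ^ ((n + 1) / (2 - γ))) ∧
        MemLp (fun f => G f - SPP.deepONet β τ f) 2 μ ∧
        eLpNorm (fun f => G f - SPP.deepONet β τ f) 2 μ ≤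
          ENNReal.ofReal (C * ((p : ℝ) ^ (-n) + Real.exp (-(Real.pi ^ 2 * l ^ 2 * (K : ℝ) ^ 2))
            + Real.exp (-(Real.pi ^ 2 * l ^ 2 * (M : ℝ) ^ 2)))) := by
  obtain ⟨b, b', hb', hb, hba⟩ := SPP.exists_hasDerivAt_extension ha
  obtain ⟨d, d', hd', hd, hdc⟩ := SPP.exists_hasDerivAt_extension hc
  have hbc : Continuous b := continuous_iff_continuousAt.2 fun x => (hb x).continuousAt
  have hdcont : Continuous d := continuous_iff_continuousAt.2 fun x => (hd x).continuousAt
  obtain ⟨C, hC, htrunk⟩ := SPP.exists_trunk_of_isWeakSolution hα hb hb' hd hd'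
    (fun x hx => (haα x hx).trans_eq (hba hx).symm) Λ.2 hn hγ
  have hT := Real.sqrt_nonneg (SPP.traceBound l₀)
  have hΛ0 : (0 : ℝ) ≤ Λ := Λ.2
  have hCT : 0 ≤ √(SPP.traceBound l₀) * (3 * C + 4 * Λ) := by positivity
  -- The first summand serves the error bound. The 6 serves the sizes: with `r = p ^ ((n + 1) / (2 -
  -- γ))`, the total trunk size is at most `p + r + 4 ≤ 6 max p r`.
  refine ⟨√(SPP.traceBound l₀) * (3 * C + 4 * Λ) + 6, by linarith, ?_⟩
  intro ε hε G hG hΛ l hl μ hμ m p M K hm hp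
  obtain ⟨T, hTG, hTΛ, hw⟩ := hG.exists_continuousLinearMap hbc hdcont hba hdc hΛ
  obtain ⟨τ, hτ, hτ₀, hτv⟩ := htrunk ε hε p K hp (fun k => G (SPP.hartleyLp ((k : ℕ) - K)))
    (fun k => hw _) fun k => by
      rw [← hTG]
      simpa [SPP.norm_hartleyLp] using T.le_of_opNorm_le hTΛ (SPP.hartleyLp ((k : ℕ) - K))
  have herr := hμ.eLpNorm_sub_deepONet_le hl.1 hl.2 hm hp hτ₀ hTΛ
    (fun k => by rw [hTG]; exact hτv k)
  simp only [hTG] at herr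
  have hp1 : (1 : ℝ) ≤ p := by
    have : 1 ≤ p := by omega
    exact_mod_cast this
  have hr : 1 ≤ (p : ℝ) ^ ((n + 1) / (2 - γ)) :=
    Real.one_le_rpow hp1 (div_nonneg (by linarith) (by linarith [hγ.2]))
  refine ⟨SPP.hartleyBranch m p K M, τ, ?_, ?_, ?_, herr.1, herr.2.trans ?_⟩
  · rw [SPP.size_hartleyBranch]
    push_cast
    have h1 := le_max_left (m : ℝ) p
    have h2 := le_max_right (m : ℝ) p
    nlinarith [mul_nonneg hCT (by linarith : 0 ≤ max (m : ℝ) p)]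
  · nlinarith [mul_nonneg hCT (by linarith : 0 ≤ (p : ℝ) ^ ((n + 1) / (2 - γ)))]
  · have h1 := le_max_left (p : ℝ) ((p : ℝ) ^ ((n + 1) / (2 - γ)))
    have h2 := le_max_right (p : ℝ) ((p : ℝ) ^ ((n + 1) / (2 - γ)))
    have h3 : (τ.size : ℝ) = 1 + τ.hiddenSize + (p + 1) := by
      rw [SPP.ReLUNet.size]; push_cast; ring
    rw [h3]
    nlinarith [mul_nonneg hCT (by linarith : 0 ≤ max (p : ℝ) ((p : ℝ) ^ ((n + 1) / (2 - γ))))]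
  · refine ENNReal.ofReal_le_ofReal ?_
    set EK := Real.exp (-(Real.pi ^ 2 * l ^ 2 * (K : ℝ) ^ 2))
    set EM := Real.exp (-(Real.pi ^ 2 * l ^ 2 * (M : ℝ) ^ 2))
    have hE : 0 < EK + EM := add_pos (Real.exp_pos _) (Real.exp_pos _)
    set q := (p : ℝ) ^ (-n)
    have hq0 : 0 ≤ q := Real.rpow_nonneg (by linarith) _
    have hq1 : q ≤ 1 := Real.rpow_le_one_of_one_le_of_nonpos hp1 (by linarith)
    have hCq : C * q ≤ C := mul_le_of_le_one_right hC hq1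
    -- Here `δ = C q` is replaced by `C` in the product with the exponentials, as `q ≤ 1`.
    have h1 : C * q + 2 * (2 * Λ + C * q) * (EK + EM) ≤ (3 * C + 4 * Λ) * (q + (EK + EM)) := by
      have h2 : 2 * (2 * Λ + C * q) * (EK + EM) ≤ 2 * (2 * Λ + C) * (EK + EM) := by gcongr
      have h3 : 0 ≤ (2 * C + 4 * Λ) * q + C * (EK + EM) := by positivity
      linarith
    have h4 := mul_le_mul_of_nonneg_left h1 hT
    have h5 : 0 ≤ 6 * (q + (EK + EM)) := by positivity
    linarith
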